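/- Let $\Sigma$ be a finite alphabet with at least two letters, and equip $\Sigma^\omega$ with the Cantor topology (the product topology, with $\Sigma$ discrete). Let $\mathsf{Regular}$ be the class of $\omega$-regular languages over $\Sigma$, i.e. those recognized by finite-state nondeterministic B\"uchi automata. A probabilistic B\"uchi automaton (PBA) $\mathcal{B}=(Q,q_s,Q_f,\delta)$ over $\Sigma$ consists of a finite set $Q$ of states, an initial state $q_s\in Q$, a set $Q_f\subseteq Q$ of final states, and a function $\delta:Q\times\Sigma\times Q\to[0,1]$ with $\sum_{q'\in Q}\delta(q,a,q')=1$ for all $q\in Q$, $a\in\Sigma$. For $\alpha=\alpha_0\alpha_1\ldots\in\Sigma^\omega$ let $\mu_{\mathcal{B},\alpha}$ be the law on $Q^\omega$ of the Markov chain that starts in $q_s$ and at time $n$ moves from $q$ to $q'$ with probability $\delta(q,\alpha_n,q')$, and let $\mathcal{L}_{>0}(\mathcal{B})$ be the set of all $\alpha$ such that $\mu_{\mathcal{B},\alpha}$ gives positive measure to the set of sequences that visit $Q_f$ infinitely often. Let $\mathsf{Probable}$ be the class of all languages $\mathcal{L}_{>0}(\mathcal{B})$ with $\mathcal{B}$ a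 PBA over $\Sigma$, and let $\mathsf{BCl}(\mathcal{G}_\delta)$ be the smallest class of subsets of $\Sigma^\omega$ that contains all $G_\delta$ sets and is closed under complement, union and intersection. Then: 1. $\mathsf{Regular}\subsetneq\mathsf{Probable}$. 2. $\mathsf{Probable}\subsetneq\mathsf{BCl}(\mathcal{G}_\delta)$. 3. For every $\mathsf{L}\in\mathsf{Probable}$, the topological closure of $\mathsf{L}$ in $\Sigma^\omega$ is $\omega$-regular. 4. For any two distinct letters $a,b\in\Sigma$, the infinite word $\alpha=abaabb\ldots a^ib^ia^{i+1}b^{i+1}\ldots$ is not ultimately periodic, and $\{\alpha\}$ is a closed set that belongs to $\mathsf{BCl}(\mathcal{G}_\delta)$ but not to $\mathsf{Probable}$. -/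

import Mathlib

open Set MeasureTheory
open scoped NNReal ENNReal

/-- A (nondeterministic) Büchi automaton over the alphabet `A` with state set `Q`. -/
structure BuchiAutomaton (A Q : Type*) where
  /-- the initial state -/
  init : Q
  /-- the final (accepting) states -/
  final : Set Q
  /-- the transition relation -/
  trans : Set (Q × A × Q)

namespace BuchiAutomaton

variable {A Q : Type*}

/-- `r` is a run of the automaton on the infinite word `w`. -/
def IsRun (M : BuchiAutomaton A Q) (w : ℕ → A) (r : ℕ → Q) : Prop :=
  r 0 = M.init ∧ ∀ i, (r i, w i, r (i + 1)) ∈ M.trans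

/-- The language of a Büchi automaton: the words that have a run in which some final state
appears infinitely often. -/
def language (M : BuchiAutomaton A Q) : Set (ℕ → A) :=
  {w | ∃ r, M.IsRun w r ∧ ∃ q ∈ M.final, ∀ n, ∃ i, n ≤ i ∧ r i = q}

end BuchiAutomaton

/-- The class of `ω`-regular languages over `A`. -/
def OmegaRegular (A : Type*) : Set (Set (ℕ → A)) :=
  {L | ∃ (Q : Type) (_ : Finite Q) (M : BuchiAutomaton A Q), M.language = L}

/-- A probabilistic Büchi automaton over the alphabet `A` with finite state set `Q`.
As the transition probabilities out of a state sum to `1`, they lie in the unit interval. -/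
structure PBA (A Q : Type*) [Fintype Q] where
  /-- the initial state -/
  init : Q
  /-- the final (accepting) states -/
  final : Set Q
  /-- the transition probabilities -/
  δ : Q → A → Q → ℝ≥0
  /-- for all `q` and `a`, the map `δ q a` is a probability distribution -/
  sum_δ : ∀ q a, ∑ q', δ q a q' = 1

namespace PBA

variable {A Q : Type*} [Fintype Q]

/-- The distribution of the next state from state `q` on the letter `a`. -/
noncomputable def step (B : PBA A Q) (q : Q) (a : A) : PMF Q :=
  PMF.ofFintype (fun q' => (B.δ q a q' : ℝ≥0∞)) (by
    rw [← ENNReal.ofNNReal_finsetSum, B.sum_δ, ENNReal.coe_one])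

variable [MeasurableSpace Q] [DiscreteMeasurableSpace Q]

/-- The transition kernel at time `n` on the input word `w`: from the history
`q₀, …, qₙ`, the next state is drawn according to `δ qₙ (w n)`. -/
noncomputable def stepKernel (B : PBA A Q) (w : ℕ → A) (n : ℕ) :
    ProbabilityTheory.Kernel ((i : Finset.Iic n) → (fun _ : ℕ => Q) i) Q :=
  ProbabilityTheory.Kernel.ofFunOfCountable
    fun h => (B.step (h ⟨n, Finset.mem_Iic.2 le_rfl⟩) (w n)).toMeasure

instance (B : PBA A Q) (w : ℕ → A) (n : ℕ) :
    ProbabilityTheory.IsMarkovKernel (B.stepKernel w n) :=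
  ⟨fun h => PMF.toMeasure.isProbabilityMeasure
    (B.step (h ⟨n, Finset.mem_Iic.2 le_rfl⟩) (w n))⟩

/-- The probability measure on the runs `ℕ → Q` generated by the automaton and the input
word `w`: the law of the Markov chain that starts in the initial state. -/
noncomputable def runMeasure (B : PBA A Q) (w : ℕ → A) : Measure (ℕ → Q) :=
  ProbabilityTheory.Kernel.traj (X := fun _ : ℕ => Q) (B.stepKernel w) 0 (fun _ => B.init)

instance (B : PBA A Q) (w : ℕ → A) : IsProbabilityMeasure (B.runMeasure w) := by
  unfold runMeasure; infer_instance

open Classical in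
/-- The values of the run measure on cylinders, which determine it. -/
theorem runMeasure_cylinder (B : PBA A Q) (w : ℕ → A) (s : ℕ → Q) (n : ℕ) :
    B.runMeasure w {r | ∀ i ≤ n, r i = s i} =
      if s 0 = B.init then
        ∏ i ∈ Finset.range n, (B.δ (s i) (w i) (s (i + 1)) : ℝ≥0∞)
      else 0 := by
  have key : ∀ m, {r : ℕ → Q | ∀ i ≤ m, r i = s i} =
      Preorder.frestrictLe (π := fun _ : ℕ => Q) m ⁻¹'
        {Preorder.frestrictLe (π := fun _ : ℕ => Q) m s} := by
    intro m
    ext r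
    simp [funext_iff, Preorder.frestrictLe]
  have ms : ∀ (m : ℕ) (x : (i : Finset.Iic m) → (fun _ : ℕ => Q) i), MeasurableSet {x} :=
    fun m x => measurableSet_singleton x
  induction n with
  | zero =>
    rw [key, ← Measure.map_apply (Preorder.measurable_frestrictLe 0) (ms _ _), runMeasure,
      ProbabilityTheory.Kernel.traj_map_frestrictLe_apply,
      ProbabilityTheory.Kernel.partialTraj_self, ProbabilityTheory.Kernel.id_apply,
      Measure.dirac_apply' _ (ms _ _)]
    by_cases h : s 0 = B.init
    · rw [if_pos h, Set.indicator_of_mem]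
      · simp
      · rw [mem_singleton_iff]
        funext i
        have : (i : ℕ) = 0 := Nat.le_zero.1 (Finset.mem_Iic.1 i.2)
        simp [Preorder.frestrictLe, this, h]
    · rw [if_neg h, Set.indicator_of_notMem]
      rw [mem_singleton_iff]
      intro h'
      exact h (congrFun h' ⟨0, by simp⟩).symm
  | succ n ih =>
    have e : {r : ℕ → Q | ∀ i ≤ n + 1, r i = s i} =
        (fun r => (Preorder.frestrictLe (π := fun _ : ℕ => Q) n r, r (n + 1))) ⁻¹'
          ({Preorder.frestrictLe (π := fun _ : ℕ => Q) n s} ×ˢ {s (n + 1)}) := by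
      ext r
      have h0 : (∀ i ≤ n, r i = s i) ↔ _ := Set.ext_iff.1 (key n) r
      rw [mem_preimage] at h0
      rw [mem_preimage, mem_prod, ← h0]
      change (∀ i ≤ n + 1, r i = s i) ↔ _ ∧ r (n + 1) = s (n + 1)
      constructor
      · exact fun h => ⟨fun i hi => h i (by lia), h _ le_rfl⟩
      · rintro ⟨h1, h2⟩ i hi
        rcases Nat.le_succ_iff.1 hi with h | h
        · exact h1 i h
        · subst h; exact h2
    have mm : Measurable fun r : ℕ → Q =>
        (Preorder.frestrictLe (π := fun _ : ℕ => Q) n r, r (n + 1)) :=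
      (Preorder.measurable_frestrictLe n).prodMk (measurable_pi_apply _)
    rw [e, ← Measure.map_apply mm ((ms _ _).prod (measurableSet_singleton _)), runMeasure,
      ← ProbabilityTheory.Kernel.partialTraj_compProd_eq_map_traj (Nat.zero_le n),
      Measure.compProd_apply_prod (ms _ _) (measurableSet_singleton _),
      lintegral_singleton' (Measurable.of_discrete),
      ← ProbabilityTheory.Kernel.traj_map_frestrictLe_apply,
      Measure.map_apply (Preorder.measurable_frestrictLe n) (ms _ _), ← key]
    rw [runMeasure] at ih
    rw [ih]
    have hk : (B.stepKernel w n (Preorder.frestrictLe (π := fun _ : ℕ => Q) n s))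
        {s (n + 1)} = (B.δ (s n) (w n) (s (n + 1)) : ℝ≥0∞) := by
      change (B.step (s n) (w n)).toMeasure {s (n + 1)} = _
      rw [PMF.toMeasure_apply_singleton _ _ (measurableSet_singleton _)]
      rfl
    rw [hk]
    split_ifs with h
    · rw [Finset.prod_range_succ, mul_comm]
    · simp

/-- The accepting runs: those that visit final states infinitely often. -/
def acceptingRuns (B : PBA A Q) : Set (ℕ → Q) :=
  {r | ∀ n, ∃ i, n ≤ i ∧ r i ∈ B.final}

/-- The probable semantics: the words accepted with positive probability. -/
def probableLanguage (B : PBA A Q) : Set (ℕ → A) :=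
  {w | 0 < B.runMeasure w B.acceptingRuns}

end PBA

/-- The class of languages over `A` of the form `L_{>0}(B)` for a probabilistic Büchi
automaton `B`; the finite state set carries its (unique) discrete `σ`-algebra. -/
def Probable (A : Type*) : Set (Set (ℕ → A)) :=
  {L | ∃ (Q : Type) (_ : Fintype Q) (_ : MeasurableSpace Q) (_ : DiscreteMeasurableSpace Q)
    (B : PBA A Q), L = B.probableLanguage}

/-- The class `BCl(G_δ)`: the Boolean closure of the `G_δ` languages, that is, the least class
that contains them and is closed under complement, union and intersection. On `ℕ → A`, with
`A` discrete, the product topology is the Cantor topology. -/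
def BClGδ (A : Type*) [TopologicalSpace A] : Set (Set (ℕ → A)) :=
  (BooleanSubalgebra.closure {L : Set (ℕ → A) | IsGδ L} : BooleanSubalgebra (Set (ℕ → A)))

/-- A word is ultimately periodic if it has the form `u v v v …` with `v` nonempty. -/
def UltimatelyPeriodic {A : Type*} (w : ℕ → A) : Prop :=
  ∃ N p, 0 < p ∧ ∀ n, N ≤ n → w (n + p) = w n

/-- The finite word `a b a a b b … aᵐ bᵐ`. -/
def abBlocks {A : Type*} (a b : A) (m : ℕ) : List A :=
  (List.range m).flatMap fun i => List.replicate (i + 1) a ++ List.replicate (i + 1) b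

theorem length_abBlocks {A : Type*} (a b : A) (m : ℕ) :
    (abBlocks a b m).length = m * (m + 1) := by
  induction m with
  | zero => simp [abBlocks]
  | succ m ih =>
    rw [abBlocks, List.range_succ, List.flatMap_append, List.length_append]
    rw [abBlocks] at ih
    rw [ih]
    simp
    ring

/-- The infinite word `a b a a b b … aⁱ bⁱ aⁱ⁺¹ bⁱ⁺¹ …`, whose `n`-th letter is read off the
sufficiently long prefix `a b … aⁿ⁺¹ bⁿ⁺¹`. -/
def abWord {A : Type*} (a b : A) (n : ℕ) : A :=
  (abBlocks a b (n + 1))[n]'(by rw [length_abBlocks]; nlinarith)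

/-! Everything is expressed through `PBA.val`, the probability of acceptance from a state on a word.

Closures: a finite word is a prefix of an accepted word exactly when transitions of positive
probability lead along it to a state that accepts some word with positive probability. This is
finite information, so by König's lemma a Büchi automaton with all states final recognizes the
closure (`closure_mem_omegaRegular`). A nonempty ω-regular language contains an ultimately periodic
word; as singletons are closed, the singleton of a word that is not ultimately periodic is never
probable. This also makes the second inclusion strict.

Regular languages are probable: a nondeterministic run jumps at a guessed time into a deterministic
breakpoint construction. A random choice makes the right guess with positive probability, and
afterwards acceptance is almost sure (`semiPBA_probableLanguage`). The inclusion is strict because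
`PBA.blockPBA` accepts `PBA.squareWord` but no ultimately periodic word.

Probable languages are Boolean combinations of G_δ sets: take the largest `n` such that on some
suffix of the word `n` states reject with probability at least one half, each inside its own color
class of a time-dependent coloring of the states. The word is accepted exactly when, for this `n`,
such a configuration exists in which moreover a reachable state stays uncolored with probability at
least one half (`PBA.probableLanguage_eq_biUnion`). If the word is accepted, Lévy's zero-one law
separates accepting from rejecting runs by whether `PBA.val` exceeds one half. If it is not, the
reachable state rejects too and yields `n + 1` separated states. Both conditions are F_σ, being
countable unions of projections of closed sets along a compact space of colorings. -/

/-! ### Shifts and cylinders of sequences. -/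

/-- The sequence without its first `n` entries. -/
def dropSeq {α : Type*} (n : ℕ) (w : ℕ → α) : ℕ → α := fun k => w (n + k)

@[simp] theorem dropSeq_apply {α : Type*} (n : ℕ) (w : ℕ → α) (k : ℕ) :
    dropSeq n w k = w (n + k) := rfl

@[simp] theorem dropSeq_zero {α : Type*} (w : ℕ → α) : dropSeq 0 w = w := by
  funext k; simp

theorem dropSeq_dropSeq {α : Type*} (m n : ℕ) (w : ℕ → α) :
    dropSeq m (dropSeq n w) = dropSeq (n + m) w := by
  funext k; simp [add_assoc]

theorem measurable_dropSeq {α : Type*} [MeasurableSpace α] (n : ℕ) :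
    Measurable (dropSeq n : (ℕ → α) → ℕ → α) :=
  measurable_pi_lambda _ fun _ => measurable_pi_apply _

theorem continuous_dropSeq {α : Type*} [TopologicalSpace α] (n : ℕ) :
    Continuous (dropSeq n : (ℕ → α) → ℕ → α) :=
  continuous_pi fun _ => continuous_apply _

/-- The sequences that agree with `s` up to time `n`. -/
def prefixCylinder {Q : Type*} (s : ℕ → Q) (n : ℕ) : Set (ℕ → Q) := {r | ∀ i ≤ n, r i = s i}

theorem prefixCylinder_eq_preimage {Q : Type*} (s : ℕ → Q) (n : ℕ) :
    prefixCylinder s n = Preorder.frestrictLe (π := fun _ : ℕ => Q) n ⁻¹'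
      {Preorder.frestrictLe (π := fun _ : ℕ => Q) n s} := by
  ext r
  simp [prefixCylinder, funext_iff, Preorder.frestrictLe]

section

variable {Q : Type*} [Fintype Q] [MeasurableSpace Q] [DiscreteMeasurableSpace Q]

theorem measurableSet_prefixCylinder (s : ℕ → Q) (n : ℕ) :
    MeasurableSet (prefixCylinder s n) := by
  rw [prefixCylinder_eq_preimage]
  exact Preorder.measurable_frestrictLe n (measurableSet_singleton _)

/-- Finite measures on sequences are determined by their values on cylinders. -/
theorem ext_of_prefixCylinder [Nonempty Q] {μ ν : Measure (ℕ → Q)} [IsFiniteMeasure μ]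
    [IsFiniteMeasure ν] (h : ∀ s n, μ (prefixCylinder s n) = ν (prefixCylinder s n)) : μ = ν := by
  have hmap : ∀ n, μ.map (Preorder.frestrictLe (π := fun _ : ℕ => Q) n) =
      ν.map (Preorder.frestrictLe (π := fun _ : ℕ => Q) n) := by
    intro n
    refine Measure.ext_of_singleton fun x => ?_
    rw [Measure.map_apply (Preorder.measurable_frestrictLe n) (measurableSet_singleton _),
      Measure.map_apply (Preorder.measurable_frestrictLe n) (measurableSet_singleton _)]
    obtain ⟨q⟩ := ‹Nonempty Q›
    let s : ℕ → Q := fun i => if hi : i ≤ n then x ⟨i, Finset.mem_Iic.2 hi⟩ else q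
    have : x = Preorder.frestrictLe (π := fun _ : ℕ => Q) n s := by
      funext i
      simp [s, Preorder.frestrictLe, Finset.mem_Iic.1 i.2]
    rw [this, ← prefixCylinder_eq_preimage]
    exact h s n
  have hI : ∀ I : Finset ℕ, μ.map (I.restrict (π := fun _ : ℕ => Q)) =
      ν.map (I.restrict (π := fun _ : ℕ => Q)) := by
    intro I
    have hsub : I ⊆ Finset.Iic (I.sup id) := fun i hi =>
      Finset.mem_Iic.2 (Finset.le_sup (f := id) hi)
    have : I.restrict (π := fun _ : ℕ => Q) = Finset.restrict₂ (π := fun _ : ℕ => Q) hsub ∘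
      Preorder.frestrictLe (π := fun _ : ℕ => Q) (I.sup id) := by
      funext r; rfl
    rw [this, ← Measure.map_map (Finset.measurable_restrict₂ _)
      (Preorder.measurable_frestrictLe _), hmap, Measure.map_map (Finset.measurable_restrict₂ _)
      (Preorder.measurable_frestrictLe _)]
  exact IsProjectiveLimit.unique (α := fun _ : ℕ => Q)
    (P := fun I => ν.map (I.restrict (π := fun _ : ℕ => Q)))
    hI fun I => rfl

end

/-! ### The Markov property and the acceptance probability. -/

namespace PBA

variable {A Q : Type*} [Fintype Q]

/-- The automaton with initial state `q`. -/
def startAt (B : PBA A Q) (q : Q) : PBA A Q := { B with init := q }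

theorem preimage_dropSeq_acceptingRuns (B : PBA A Q) (n : ℕ) :
    dropSeq n ⁻¹' B.acceptingRuns = B.acceptingRuns := by
  ext r
  constructor
  · intro h m
    obtain ⟨i, hi, h⟩ := h m
    exact ⟨n + i, by lia, h⟩
  · intro h m
    obtain ⟨i, hi, h⟩ := h (n + m)
    exact ⟨i - n, by lia, by simpa [show n + (i - n) = i by lia] using h⟩

variable [MeasurableSpace Q] [DiscreteMeasurableSpace Q]

/-- The law of the run from the state `q`. -/
noncomputable def law (B : PBA A Q) (q : Q) (w : ℕ → A) : Measure (ℕ → Q) :=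
  (B.startAt q).runMeasure w

instance (B : PBA A Q) (q : Q) (w : ℕ → A) : IsProbabilityMeasure (B.law q w) := by
  unfold law; infer_instance

open Classical in
theorem law_prefixCylinder (B : PBA A Q) (q : Q) (w : ℕ → A) (s : ℕ → Q) (n : ℕ) :
    B.law q w (prefixCylinder s n) =
      if s 0 = q then ∏ i ∈ Finset.range n, (B.δ (s i) (w i) (s (i + 1)) : ℝ≥0∞) else 0 :=
  (B.startAt q).runMeasure_cylinder w s n

/-- It suffices to compare both sides on cylinders: the prefix `s` followed by `t` is one longer
word `u`, and the product of transition probabilities along `u` splits at time `n`. -/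
theorem law_prefixCylinder_inter (B : PBA A Q) (q : Q) (w : ℕ → A) (s : ℕ → Q) (n : ℕ)
    {E : Set (ℕ → Q)} (hE : MeasurableSet E) :
    B.law q w (prefixCylinder s n ∩ dropSeq n ⁻¹' E) =
      B.law q w (prefixCylinder s n) * B.law (s n) (dropSeq n w) E := by
  classical
  have : Nonempty Q := ⟨q⟩
  have key : ((B.law q w).restrict (prefixCylinder s n)).map (dropSeq n) =
      (B.law q w (prefixCylinder s n)) • B.law (s n) (dropSeq n w) := by
    have : IsFiniteMeasure (((B.law q w).restrict (prefixCylinder s n)).map (dropSeq n)) :=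
      Measure.isFiniteMeasure_map _ _
    have : IsFiniteMeasure ((B.law q w (prefixCylinder s n)) • B.law (s n) (dropSeq n w)) :=
      Measure.smul_finite _ (measure_ne_top _ _)
    refine ext_of_prefixCylinder fun t m => ?_
    rw [Measure.map_apply (measurable_dropSeq n) (measurableSet_prefixCylinder _ _),
      Measure.restrict_apply (measurable_dropSeq n (measurableSet_prefixCylinder _ _)),
      Measure.smul_apply, smul_eq_mul, law_prefixCylinder B (s n)]
    by_cases ht : t 0 = s n
    · let u : ℕ → Q := fun i => if i ≤ n then s i else t (i - n)
      have hu1 : ∀ i ≤ n, u i = s i := fun i hi => by simp [u, hi]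
      have hu2 : ∀ i, u (n + i) = t i := by
        intro i
        rcases Nat.eq_zero_or_pos i with rfl | hi
        · simp [u, ht]
        · have : ¬ n + i ≤ n := by lia
          simp [u, this]
      have : dropSeq n ⁻¹' prefixCylinder t m ∩ prefixCylinder s n =
          prefixCylinder u (n + m) := by
        ext r
        constructor
        · rintro ⟨h1, h2⟩ i hi
          rcases le_total i n with h | h
          · rw [hu1 i h, h2 i h]
          · obtain ⟨j, rfl⟩ := Nat.exists_eq_add_of_le h
            rw [hu2]
            exact h1 j (by lia)
        · intro h
          refine ⟨fun j hj => ?_, fun i hi => ?_⟩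
          · rw [← hu2]; exact h (n + j) (by lia)
          · rw [← hu1 i hi]; exact h i (by lia)
      rw [this, if_pos ht, law_prefixCylinder, law_prefixCylinder, hu1 0 (Nat.zero_le _)]
      split_ifs with h0
      · rw [Finset.prod_range_add]
        congr 1
        · refine Finset.prod_congr rfl fun i hi => ?_
          have := Finset.mem_range.1 hi
          rw [hu1 i (by lia), hu1 (i + 1) (by lia)]
        · refine Finset.prod_congr rfl fun i _ => ?_
          rw [hu2 i, add_assoc, hu2 (i + 1)]; rfl
      · simp
    · rw [if_neg ht, mul_zero]
      convert measure_empty (μ := B.law q w)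
      rw [eq_empty_iff_forall_notMem]
      rintro r ⟨h1, h2⟩
      exact ht ((h1 0 (Nat.zero_le _)).symm.trans (h2 n le_rfl))
  have := congrArg (fun μ : Measure (ℕ → Q) => μ E) key
  simp only [Measure.smul_apply, smul_eq_mul] at this
  rw [← this, Measure.map_apply (measurable_dropSeq n) hE,
    Measure.restrict_apply (measurable_dropSeq n hE), inter_comm]

/-- The Markov property. -/
theorem law_inter_dropSeq (B : PBA A Q) (q : Q) (w : ℕ → A) (n : ℕ)
    (C : Set ((i : Finset.Iic n) → (fun _ : ℕ => Q) i)) {E : Set (ℕ → Q)} (hE : MeasurableSet E) :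
    B.law q w (Preorder.frestrictLe n ⁻¹' C ∩ dropSeq n ⁻¹' E) =
      ∫⁻ r in Preorder.frestrictLe n ⁻¹' C, B.law (r n) (dropSeq n w) E ∂(B.law q w) := by
  classical
  have hCu : Preorder.frestrictLe (π := fun _ : ℕ => Q) n ⁻¹' C =
      ⋃ c ∈ C.toFinset, Preorder.frestrictLe (π := fun _ : ℕ => Q) n ⁻¹' {c} := by
    ext r; simp
  have hd : Set.PairwiseDisjoint (C.toFinset : Set _)
      fun c => Preorder.frestrictLe (π := fun _ : ℕ => Q) n ⁻¹' {c} := by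
    intro c _ c' _ h
    exact Disjoint.preimage _ (disjoint_singleton.2 h)
  have hm : ∀ c, MeasurableSet (Preorder.frestrictLe (π := fun _ : ℕ => Q) n ⁻¹' {c}) :=
    fun c => Preorder.measurable_frestrictLe n (measurableSet_singleton _)
  rw [hCu, iUnion₂_inter, measure_biUnion_finset, lintegral_biUnion_finset hd fun c _ => hm c]
  · refine Finset.sum_congr rfl fun c _ => ?_
    let s : ℕ → Q := fun i => if hi : i ≤ n then c ⟨i, Finset.mem_Iic.2 hi⟩ else q
    have : c = Preorder.frestrictLe (π := fun _ : ℕ => Q) n s := by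
      funext i
      simp [s, Preorder.frestrictLe, Finset.mem_Iic.1 i.2]
    rw [this, ← prefixCylinder_eq_preimage, law_prefixCylinder_inter B q w s n hE]
    rw [setLIntegral_congr_fun (g := fun _ => B.law (s n) (dropSeq n w) E)
      (measurableSet_prefixCylinder s n), setLIntegral_const, mul_comm]
    intro r hr
    simp only
    rw [hr n le_rfl]
  · intro c hc c' hc' h
    exact (hd hc hc' h).mono inter_subset_left inter_subset_left
  · exact fun c _ => (hm c).inter (measurable_dropSeq n hE)

theorem ae_law_zero (B : PBA A Q) (q : Q) (w : ℕ → A) : ∀ᵐ r ∂(B.law q w), r 0 = q := by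
  rw [ae_iff, ← prob_compl_eq_one_iff]
  · have : {r : ℕ → Q | ¬ r 0 = q}ᶜ = prefixCylinder (fun _ => q) 0 := by
      ext r; simp [prefixCylinder]
    rw [this, law_prefixCylinder]
    simp
  · exact (measurable_pi_apply 0 : Measurable fun r : ℕ → Q => r 0)
      (.of_discrete : MeasurableSet {x : Q | ¬ x = q})

theorem law_one (B : PBA A Q) (q : Q) (w : ℕ → A) (x : Q) :
    B.law q w {r | r 1 = x} = B.δ q (w 0) x := by
  classical
  let s : ℕ → Q := fun i => if i = 0 then q else x
  have h : B.law q w {r | r 1 = x} = B.law q w (prefixCylinder s 1) := by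
    refine measure_congr ?_
    filter_upwards [B.ae_law_zero q w] with r hr
    refine propext ⟨fun h i hi => ?_, fun h => h 1 le_rfl⟩
    interval_cases i
    · exact hr
    · exact h
  rw [h, law_prefixCylinder]
  simp [s]

/-- The first step of the chain. -/
theorem law_dropSeq_one (B : PBA A Q) (q : Q) (w : ℕ → A) {E : Set (ℕ → Q)}
    (hE : MeasurableSet E) :
    B.law q w (dropSeq 1 ⁻¹' E) = ∑ x, B.δ q (w 0) x * B.law x (dropSeq 1 w) E := by
  have h := B.law_inter_dropSeq q w 1 univ hE
  rw [preimage_univ, univ_inter, Measure.restrict_univ] at h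
  rw [h]
  have h2 := lintegral_map (μ := B.law q w) (f := fun x : Q => B.law x (dropSeq 1 w) E)
    (g := fun r : ℕ → Q => r 1) (Measurable.of_discrete) (measurable_pi_apply 1)
  rw [← h2, lintegral_fintype]
  refine Finset.sum_congr rfl fun x _ => ?_
  rw [Measure.map_apply (measurable_pi_apply 1) (measurableSet_singleton _), mul_comm,
    ← B.law_one q w x]
  rfl

/-- Almost surely all transitions of the run have positive probability. -/
theorem ae_law_δ_ne_zero (B : PBA A Q) (q : Q) (w : ℕ → A) :
    ∀ᵐ r ∂(B.law q w), r 0 = q ∧ ∀ k, B.δ (r k) (w k) (r (k + 1)) ≠ 0 := by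
  refine (B.ae_law_zero q w).and (ae_all_iff.2 fun k => ?_)
  rw [ae_iff]
  have hE : MeasurableSet {r : ℕ → Q | B.δ (r 0) (w k) (r 1) = 0} := by
    have : Measurable fun r : ℕ → Q => (r 0, r 1) :=
      (measurable_pi_apply 0).prodMk (measurable_pi_apply 1)
    exact this (.of_discrete : MeasurableSet {x : Q × Q | B.δ x.1 (w k) x.2 = 0})
  have h := B.law_inter_dropSeq q w k univ hE
  have h0 : {r : ℕ → Q | ¬ B.δ (r k) (w k) (r (k + 1)) ≠ 0} =
      dropSeq k ⁻¹' {r : ℕ → Q | B.δ (r 0) (w k) (r 1) = 0} := by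
    ext r; simp
  rw [preimage_univ, univ_inter, ← h0, Measure.restrict_univ] at h
  rw [h]
  have : ∀ x, B.law x (dropSeq k w) {r : ℕ → Q | B.δ (r 0) (w k) (r 1) = 0} = 0 := by
    intro x
    have hsub : {r : ℕ → Q | B.δ (r 0) (w k) (r 1) = 0} ⊆
        {r | ¬ r 0 = x} ∪ ⋃ y ∈ {y : Q | B.δ x (w k) y = 0}, {r | r 1 = y} := by
      intro r hr
      by_cases hx : r 0 = x
      · right
        simp only [mem_iUnion]
        exact ⟨r 1, by rw [← hx]; exact hr, rfl⟩
      · exact Or.inl hx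
    refine measure_mono_null hsub (measure_union_null (B.ae_law_zero x _) ?_)
    refine (measure_biUnion_null_iff (to_countable _)).2 fun y hy => ?_
    rw [law_one]
    simpa using hy
  simp [this]

theorem measurableSet_acceptingRuns (B : PBA A Q) : MeasurableSet B.acceptingRuns := by
  have : B.acceptingRuns = ⋂ n, ⋃ i, ⋃ (_ : n ≤ i), (fun r : ℕ → Q => r i) ⁻¹' B.final := by
    ext r; simp [acceptingRuns]
  rw [this]
  exact .iInter fun n => .iUnion fun i => .iUnion fun _ =>
    measurable_pi_apply i (.of_discrete : MeasurableSet B.final)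

/-- The probability of acceptance from the state `q`. -/
noncomputable def val (B : PBA A Q) (q : Q) (w : ℕ → A) : ℝ≥0∞ := B.law q w B.acceptingRuns

theorem val_le_one (B : PBA A Q) (q : Q) (w : ℕ → A) : B.val q w ≤ 1 := prob_le_one

theorem mem_probableLanguage_iff (B : PBA A Q) (w : ℕ → A) :
    w ∈ B.probableLanguage ↔ 0 < B.val B.init w := Iff.rfl

theorem val_eq_sum (B : PBA A Q) (q : Q) (w : ℕ → A) :
    B.val q w = ∑ x, B.δ q (w 0) x * B.val x (dropSeq 1 w) := by
  rw [val, ← B.preimage_dropSeq_acceptingRuns 1, law_dropSeq_one _ _ _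
    B.measurableSet_acceptingRuns]
  simp [val]

end PBA

theorem measurableSet_forall_mem {Q : Type*} [MeasurableSpace Q] [DiscreteMeasurableSpace Q]
    (D : ℕ → Set Q) : MeasurableSet {r : ℕ → Q | ∀ k, r k ∈ D k} := by
  rw [ofPred_forall]
  exact .iInter fun k => measurable_pi_apply k (.of_discrete : MeasurableSet (D k))

/-! ### The zero-one law and restarting at late times. -/

namespace PBA

variable {A Q : Type*} [Fintype Q] [MeasurableSpace Q] [DiscreteMeasurableSpace Q]

/-- Lévy's zero-one law for the event of acceptance. -/
theorem ae_tendsto_val (B : PBA A Q) (q : Q) (w : ℕ → A) :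
    ∀ᵐ r ∂(B.law q w), Filter.Tendsto (fun n => (B.val (r n) (dropSeq n w)).toReal) Filter.atTop
      (nhds (B.acceptingRuns.indicator (fun _ => (1 : ℝ)) r)) := by
  let μ := B.law q w
  let ℱ := Filtration.piLE (X := fun _ : ℕ => Q)
  let g : (ℕ → Q) → ℝ := B.acceptingRuns.indicator fun _ => 1
  have hg : Integrable g μ := (integrable_const (1 : ℝ)).indicator B.measurableSet_acceptingRuns
  -- By the Markov property the value at time `n` is the conditional probability of acceptance given
  -- the history, so Lévy's upward theorem applies.
  have hcond : ∀ n, (fun r : ℕ → Q => (B.val (r n) (dropSeq n w)).toReal) =ᵐ[μ] μ[g | ℱ n] := by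
    intro n
    have hmeas : Measurable[ℱ n] fun r : ℕ → Q => (B.val (r n) (dropSeq n w)).toReal := by
      have h1 : (fun r : ℕ → Q => (B.val (r n) (dropSeq n w)).toReal) =
          (fun c : (i : Finset.Iic n) → (fun _ : ℕ => Q) i =>
            (B.val (c ⟨n, Finset.mem_Iic.2 le_rfl⟩) (dropSeq n w)).toReal) ∘
          Preorder.frestrictLe n := rfl
      rw [h1]
      change Measurable[(Filtration.piLE (X := fun _ : ℕ => Q)) n] _
      rw [Filtration.piLE_eq_comap_frestrictLe]
      exact Measurable.of_discrete.comp (comap_measurable _)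
    have hint : Integrable (fun r : ℕ → Q => (B.val (r n) (dropSeq n w)).toReal) μ := by
      refine Integrable.of_bound (C := 1) (hmeas.mono (ℱ.le n) le_rfl).aestronglyMeasurable ?_
      refine Filter.Eventually.of_forall fun r => ?_
      rw [Real.norm_of_nonneg ENNReal.toReal_nonneg]
      exact ENNReal.toReal_le_of_le_ofReal zero_le_one (by simpa using B.val_le_one _ _)
    refine ae_eq_condExp_of_forall_setIntegral_eq (ℱ.le n) hg (fun s _ _ => hint.integrableOn)
      (fun s hs _ => ?_) hmeas.stronglyMeasurable.aestronglyMeasurable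
    have hs' := ℱ.le n s hs
    change MeasurableSet[(Filtration.piLE (X := fun _ : ℕ => Q)) n] s at hs
    rw [Filtration.piLE_eq_comap_frestrictLe] at hs
    obtain ⟨C, -, rfl⟩ := hs
    have h := B.law_inter_dropSeq q w n C B.measurableSet_acceptingRuns
    rw [preimage_dropSeq_acceptingRuns] at h
    rw [setIntegral_indicator B.measurableSet_acceptingRuns, setIntegral_const, smul_eq_mul,
      mul_one, integral_toReal, measureReal_def]
    · exact congrArg ENNReal.toReal h.symm
    · exact (Measurable.of_discrete (f := fun x : Q => B.val x (dropSeq n w))).comp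
        (measurable_pi_apply n) |>.aemeasurable
    · exact Filter.Eventually.of_forall fun r => (B.val_le_one _ _).trans_lt ENNReal.one_lt_top
  have hsup : (⨆ n, ℱ n) = MeasurableSpace.pi := by
    refine le_antisymm (iSup_le fun n => ℱ.le n) (iSup_le fun n => ?_)
    refine le_trans ?_ (le_iSup _ n)
    change _ ≤ (Filtration.piLE (X := fun _ : ℕ => Q)) n
    rw [Filtration.piLE_eq_comap_frestrictLe]
    have h1 : (fun r : ℕ → Q => r n) =
        (fun c : (i : Finset.Iic n) → (fun _ : ℕ => Q) i => c ⟨n, Finset.mem_Iic.2 le_rfl⟩) ∘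
          Preorder.frestrictLe n := rfl
    rw [h1, ← MeasurableSpace.comap_comp]
    exact MeasurableSpace.comap_mono (measurable_pi_apply _).comap_le
  have hgm : StronglyMeasurable[⨆ n, ℱ n] g := by
    rw [hsup]
    exact stronglyMeasurable_const.indicator B.measurableSet_acceptingRuns
  filter_upwards [hg.tendsto_ae_condExp hgm, ae_all_iff.2 hcond] with r h1 h2
  simpa only [h2] using h1

/-- If the run is eventually in `D` with positive probability, then at all large times there is a
reachable state from which it stays in `D` with probability at least one half. -/
theorem exists_half_le_law_of_pos (B : PBA A Q) (q : Q) (w : ℕ → A) (D : ℕ → Set Q)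
    (h : 0 < B.law q w {r | ∃ N, ∀ k, r (N + k) ∈ D (N + k)}) :
    ∃ N, ∀ m, N ≤ m → ∃ x, 0 < B.law q w {r | r m = x} ∧
      2⁻¹ ≤ B.law x (dropSeq m w) {r | ∀ k, r k ∈ D (m + k)} := by
  obtain ⟨N, hN⟩ : ∃ N, 0 < B.law q w {r | ∀ k, r (N + k) ∈ D (N + k)} := by
    by_contra! hc
    rw [ofPred_exists] at h
    exact h.ne' (measure_iUnion_null fun N => nonpos_iff_eq_zero.1 (hc N))
  let C : ∀ m, Set ((i : Finset.Iic m) → (fun _ : ℕ => Q) i) :=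
    fun m => {c | ∀ i : Finset.Iic m, N ≤ i.1 → c i ∈ D i}
  let S : ℕ → Set (ℕ → Q) := fun m => Preorder.frestrictLe (π := fun _ : ℕ => Q) m ⁻¹' C m
  have hS : ∀ m r, r ∈ S m ↔ ∀ i, N ≤ i → i ≤ m → r i ∈ D i := by
    intro m r
    constructor
    · exact fun h i hi him => h ⟨i, Finset.mem_Iic.2 him⟩ hi
    · exact fun h i hi => h i hi (Finset.mem_Iic.1 i.2)
  have hSm : ∀ m, MeasurableSet (S m) :=
    fun m => Preorder.measurable_frestrictLe m .of_discrete
  have hlim : Filter.Tendsto (fun m => B.law q w (S m)) Filter.atTop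
      (nhds (B.law q w {r | ∀ k, r (N + k) ∈ D (N + k)})) := by
    have : {r : ℕ → Q | ∀ k, r (N + k) ∈ D (N + k)} = ⋂ m, S m := by
      ext r
      simp only [mem_ofPred_eq, mem_iInter, hS]
      constructor
      · intro h m i hi _
        obtain ⟨k, rfl⟩ := Nat.exists_eq_add_of_le hi
        exact h k
      · exact fun h k => h (N + k) _ (by lia) le_rfl
    rw [this]
    refine tendsto_measure_iInter_atTop (fun m => (hSm m).nullMeasurableSet) ?_
      ⟨0, measure_ne_top _ _⟩
    intro m m' hmm r hr
    rw [hS] at hr ⊢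
    exact fun i hi him => hr i hi (him.trans hmm)
  set a := B.law q w {r | ∀ k, r (N + k) ∈ D (N + k)} with ha
  -- Since `S m` decreases to an event of probability `a`, its probability is eventually below `2 *
  -- a`. If every reachable state stayed in `D` with probability below one half, then `a` would be
  -- at most half of that, hence less than `a`.
  have ha2 : a < 2 * a := by
    rw [two_mul]
    exact ENNReal.lt_add_right (measure_ne_top _ _) hN.ne'
  obtain ⟨M, hM⟩ := Filter.eventually_atTop.1 (hlim.eventually (gt_mem_nhds ha2))
  refine ⟨max M N, fun m hm => ?_⟩
  by_contra! hc
  have hE := measurableSet_forall_mem fun k => D (m + k)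
  have h1 : a = B.law q w (S m ∩ dropSeq m ⁻¹' {r | ∀ k, r k ∈ D (m + k)}) := by
    rw [ha]
    congr 1
    ext r
    rw [mem_inter_iff, hS]
    constructor
    · intro h
      refine ⟨fun i hi _ => ?_, fun k => ?_⟩
      · obtain ⟨k, rfl⟩ := Nat.exists_eq_add_of_le hi
        exact h k
      · have := h (m + k - N)
        rwa [show N + (m + k - N) = m + k by lia] at this
    · rintro ⟨h1, h2⟩ k
      rcases le_total (N + k) m with h | h
      · exact h1 _ (by lia) h
      · have := h2 (N + k - m)
        simpa only [dropSeq_apply, show m + (N + k - m) = N + k by lia] using this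
  rw [B.law_inter_dropSeq q w m (C m) hE] at h1
  have h2 : a ≤ ∫⁻ r in S m, 2⁻¹ ∂(B.law q w) := by
    rw [h1]
    refine lintegral_mono_ae (ae_restrict_of_ae ?_)
    have : ∀ x, ∀ᵐ r ∂(B.law q w), r m = x →
        B.law x (dropSeq m w) {r | ∀ k, r k ∈ D (m + k)} ≤ 2⁻¹ := by
      intro x
      by_cases hx : 0 < B.law q w {r | r m = x}
      · exact Filter.Eventually.of_forall fun r _ => (hc x hx).le
      · have h0 := nonpos_iff_eq_zero.1 (not_lt.1 hx)
        refine measure_mono_null (fun r hr => ?_) h0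
        simp only [mem_compl_iff, mem_ofPred_eq, not_forall] at hr
        exact hr.1
    filter_upwards [ae_all_iff.2 this] with r hr using hr (r m) rfl
  rw [setLIntegral_const] at h2
  have h3 := hM m ((le_max_left _ _).trans hm)
  have h4 : (2⁻¹ : ℝ≥0∞) * B.law q w (S m) < 2⁻¹ * (2 * a) :=
    ENNReal.mul_lt_mul_right (by simp) (by simp) h3
  rw [← mul_assoc, ENNReal.inv_mul_cancel (by simp) (by simp), one_mul] at h4
  exact absurd h2 (not_le.2 h4)

end PBA

/-! ### Closures of probable languages are ω-regular. -/

/-- König's lemma for a sequence of nonempty finite levels. -/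
theorem exists_seq_of_forall_exists_pred {Q : Type*} [Finite Q] (S : ℕ → Set Q)
    (C : ℕ → Q → Q → Prop) (hne : ∀ k, (S k).Nonempty)
    (hpred : ∀ k, ∀ x ∈ S (k + 1), ∃ y ∈ S k, C k y x) :
    ∃ r : ℕ → Q, ∀ k, r k ∈ S k ∧ C k (r k) (r (k + 1)) := by
  let : TopologicalSpace Q := ⊥
  have : DiscreteTopology Q := ⟨rfl⟩
  -- The sequences that are correct up to time `n` form a decreasing family of nonempty compact
  -- sets.
  let K : ℕ → Set (ℕ → Q) := fun n => {r | ∀ k ≤ n, r k ∈ S k ∧ (k < n → C k (r k) (r (k + 1)))}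
  have hcl : ∀ n, IsClosed (K n) := by
    intro n
    have : K n = ⋂ k, ⋂ (_ : k ≤ n), (fun r : ℕ → Q => (r k, r (k + 1))) ⁻¹'
        {x | x.1 ∈ S k ∧ (k < n → C k x.1 x.2)} := by
      ext r; simp [K]
    rw [this]
    refine isClosed_iInter fun k => isClosed_iInter fun _ => IsClosed.preimage ?_
      (isClosed_discrete _)
    exact (continuous_apply k).prodMk (continuous_apply (k + 1))
  have hK : ∀ n, ∀ x ∈ S n, ∃ r ∈ K n, r n = x := by
    intro n
    induction n with
    | zero =>
      intro x hx
      refine ⟨fun _ => x, fun k hk => ?_, rfl⟩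
      obtain rfl := Nat.le_zero.1 hk
      exact ⟨hx, fun h => absurd h (lt_irrefl _)⟩
    | succ n ih =>
      intro x hx
      obtain ⟨y, hy, hc⟩ := hpred n x hx
      obtain ⟨r, hr, rfl⟩ := ih y hy
      refine ⟨fun i => if i ≤ n then r i else x, fun k hk => ?_, by simp⟩
      rcases Nat.lt_or_ge n k with h | h
      · obtain rfl : k = n + 1 := by lia
        simpa using hx
      · refine ⟨by simpa [h] using (hr k h).1, fun _ => ?_⟩
        rcases h.lt_or_eq with h' | rfl
        · simpa [h, Nat.succ_le_of_lt h'] using (hr k h).2 h'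
        · simpa using hc
  obtain ⟨r, hr⟩ := IsCompact.nonempty_iInter_of_sequence_nonempty_isCompact_isClosed K
    (fun n r hr k hk => ⟨(hr k (by lia)).1, fun h => (hr k (by lia)).2 (by lia)⟩)
    (fun n => by
      obtain ⟨x, hx⟩ := hne n
      obtain ⟨r, hr, -⟩ := hK n x hx
      exact ⟨r, hr⟩)
    (hcl 0).isCompact hcl
  rw [mem_iInter] at hr
  exact ⟨r, fun k => ⟨(hr k k le_rfl).1, (hr (k + 1) k (by lia)).2 (by lia)⟩⟩

theorem mem_closure_iff_prefix {A : Type*} [TopologicalSpace A] [DiscreteTopology A]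
    {L : Set (ℕ → A)} {w : ℕ → A} :
    w ∈ closure L ↔ ∀ n, ∃ v ∈ L, ∀ i < n, v i = w i := by
  rw [(PiNat.isTopologicalBasis_cylinders fun _ : ℕ => A).mem_closure_iff]
  constructor
  · intro h n
    obtain ⟨v, hv, hL⟩ := h (PiNat.cylinder w n) ⟨w, n, rfl⟩ (PiNat.self_mem_cylinder w n)
    exact ⟨v, hL, hv⟩
  · rintro h _ ⟨x, n, rfl⟩ hw
    obtain ⟨v, hL, hv⟩ := h n
    exact ⟨v, fun i hi => (hv i hi).trans (hw i hi), hL⟩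

/-- The states reachable from `X` in `k` steps of the transition relation `T` along `w`. -/
def reach {A Q : Type*} (T : Set (Q × A × Q)) (X : Set Q) (w : ℕ → A) : ℕ → Set Q
  | 0 => X
  | k + 1 => {x | ∃ y ∈ reach T X w k, (y, w k, x) ∈ T}

theorem reach_congr {A Q : Type*} {T : Set (Q × A × Q)} {X : Set Q} {v w : ℕ → A} {n : ℕ}
    (h : ∀ i < n, v i = w i) : reach T X v n = reach T X w n := by
  induction n with
  | zero => rfl
  | succ n ih => rw [reach, reach, ih fun i hi => h i (by lia), h n (by lia)]

namespace PBA

variable {A Q : Type*} [Fintype Q]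

/-- The transitions of positive probability. -/
def support (B : PBA A Q) : Set (Q × A × Q) := {t | B.δ t.1 t.2.1 t.2.2 ≠ 0}

variable [MeasurableSpace Q] [DiscreteMeasurableSpace Q]

theorem val_pos_of_step (B : PBA A Q) {q x : Q} {w : ℕ → A} (h : B.δ q (w 0) x ≠ 0)
    (hx : 0 < B.val x (dropSeq 1 w)) : 0 < B.val q w := by
  rw [val_eq_sum, Finset.sum_pos_iff]
  exact ⟨x, Finset.mem_univ _, ENNReal.mul_pos (by simpa using h) hx.ne'⟩

theorem exists_step_of_val_pos (B : PBA A Q) {q : Q} {w : ℕ → A} (h : 0 < B.val q w) :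
    ∃ x, B.δ q (w 0) x ≠ 0 ∧ 0 < B.val x (dropSeq 1 w) := by
  rw [val_eq_sum, Finset.sum_pos_iff] at h
  obtain ⟨x, -, hx⟩ := h
  exact ⟨x, by simpa using left_ne_zero_of_mul hx.ne', pos_iff_ne_zero.2 (right_ne_zero_of_mul hx.ne')⟩

theorem val_pos_of_path (B : PBA A Q) (n : ℕ) {r : ℕ → Q} {w : ℕ → A}
    (h : ∀ i < n, B.δ (r i) (w i) (r (i + 1)) ≠ 0) (hn : 0 < B.val (r n) (dropSeq n w)) :
    0 < B.val (r 0) w := by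
  induction n generalizing r w with
  | zero => simpa using hn
  | succ n ih =>
    refine B.val_pos_of_step (h 0 (by lia)) (ih (r := dropSeq 1 r) (fun i hi => ?_) ?_)
    · simpa [add_comm, add_left_comm, add_assoc] using h (i + 1) (by lia)
    · rw [dropSeq_dropSeq]
      simpa [add_comm] using hn

theorem exists_mem_reach_val_pos (B : PBA A Q) {q : Q} {w : ℕ → A} (h : 0 < B.val q w) (n : ℕ) :
    ∃ x ∈ reach B.support {q} w n, 0 < B.val x (dropSeq n w) := by
  induction n with
  | zero => exact ⟨q, rfl, by simpa using h⟩
  | succ n ih =>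
    obtain ⟨x, hx, hv⟩ := ih
    obtain ⟨y, hy, hv'⟩ := B.exists_step_of_val_pos hv
    exact ⟨y, ⟨x, hx, hy⟩, by rwa [dropSeq_dropSeq] at hv'⟩

end PBA

/-- The automaton keeps the transitions of positive probability into states that accept some word
with positive probability. Any finite piece of its run can therefore be continued to an accepted
word; conversely, König's lemma assembles a run from the accepted approximations. -/
theorem closure_mem_omegaRegular {A : Type*} [TopologicalSpace A] [DiscreteTopology A]
    {L : Set (ℕ → A)} (hL : L ∈ Probable A) : closure L ∈ OmegaRegular A := by
  obtain ⟨Q, _, _, _, B, rfl⟩ := hL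
  refine ⟨Q, inferInstance, ⟨B.init, univ,
    {t | B.δ t.1 t.2.1 t.2.2 ≠ 0 ∧ ∃ v, 0 < B.val t.2.2 v}⟩, ?_⟩
  ext w
  rw [mem_closure_iff_prefix]
  constructor
  · rintro ⟨r, ⟨h0, hr⟩, -⟩ n
    obtain ⟨hδ, v, hv⟩ := hr n
    refine ⟨fun i => if i ≤ n then w i else v (i - (n + 1)), ?_, fun i hi => by simp [hi.le]⟩
    rw [PBA.mem_probableLanguage_iff, ← show r 0 = B.init from h0]
    refine B.val_pos_of_path (n + 1) (fun i hi => ?_) ?_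
    · simpa [Nat.lt_succ_iff.1 hi] using (hr i).1
    · convert hv
      funext k
      simp [show ¬ n + 1 + k ≤ n by lia]
  · intro h
    have hK := exists_seq_of_forall_exists_pred
      (fun k => {x | x ∈ reach B.support {B.init} w k ∧
        ∃ v, (∀ i < k, v i = w i) ∧ 0 < B.val x (dropSeq k v)})
      (fun k y x => B.δ y (w k) x ≠ 0 ∧ ∃ v, 0 < B.val x v) ?_ ?_
    · obtain ⟨r, hr⟩ := hK
      -- All states are final, but acceptance asks for one fixed state to recur.
      obtain ⟨q, hq⟩ := Finite.exists_infinite_fiber r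
      rw [Set.infinite_coe_iff] at hq
      refine ⟨r, ⟨(hr 0).1.1, fun i => (hr i).2⟩, q, mem_univ _, fun n => ?_⟩
      obtain ⟨i, hi, hn⟩ := hq.exists_gt n
      exact ⟨i, hn.le, hi⟩
    · intro k
      obtain ⟨v, hv, hvw⟩ := h k
      obtain ⟨x, hx, hpos⟩ := B.exists_mem_reach_val_pos hv k
      exact ⟨x, by rwa [← reach_congr hvw], v, hvw, hpos⟩
    · rintro k x ⟨⟨y, hy, hδ⟩, v, hvw, hv⟩
      have hδ' : B.δ y (w k) x ≠ 0 := hδ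
      refine ⟨y, ⟨hy, v, fun i hi => hvw i (by lia), B.val_pos_of_step (x := x) ?_ ?_⟩, hδ', _, hv⟩
      · simpa [hvw k (by lia)] using hδ'
      · rwa [dropSeq_dropSeq]

/-! ### Ultimately periodic words and the block word. -/

theorem exists_ultimatelyPeriodic_of_omegaRegular {A : Type*} {L : Set (ℕ → A)}
    (hL : L ∈ OmegaRegular A) (hne : L.Nonempty) : ∃ w ∈ L, UltimatelyPeriodic w := by
  obtain ⟨Q, _, M, rfl⟩ := hL
  obtain ⟨w, r, ⟨h0, hr⟩, q, hq, hinf⟩ := hne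
  obtain ⟨i, -, hi⟩ := hinf 0
  obtain ⟨j, hij, hj⟩ := hinf (i + 1)
  obtain ⟨p, hp, rfl⟩ : ∃ p, 0 < p ∧ j = i + p := ⟨j - i, by lia, by lia⟩
  -- The run visits `q` at times `i` and `i + p`; `σ` folds time onto this lasso, so word and run
  -- repeat the loop forever.
  let σ : ℕ → ℕ := fun k => if k < i then k else i + (k - i) % p
  have hσ0 : r (σ 0) = r 0 := by
    rcases Nat.eq_zero_or_pos i with h | h
    · simp [σ, h]
    · simp [σ, h]
  have hσ : ∀ k, r (σ (k + 1)) = r (σ k + 1) := by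
    intro k
    rcases lt_trichotomy (k + 1) i with h | h | h
    · simp [σ, h, show k < i by lia]
    · simp [σ, ← h]
    · have h1 : ¬ k < i := by lia
      have h2 : ¬ k + 1 < i := by lia
      have hlt := Nat.mod_lt (k - i) hp
      have h3 : (k + 1 - i) % p = ((k - i) % p + 1) % p := by
        rw [Nat.mod_add_mod, show k + 1 - i = k - i + 1 by lia]
      simp only [σ, h1, h2, if_false, h3]
      rcases Nat.lt_or_ge ((k - i) % p + 1) p with h4 | h4
      · rw [Nat.mod_eq_of_lt h4, add_assoc]
      · have h5 : (k - i) % p + 1 = p := by lia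
        rw [h5, Nat.mod_self, add_assoc, h5, add_zero, hi, hj]
  refine ⟨w ∘ σ, ⟨r ∘ σ, ⟨hσ0.trans h0, fun k => ?_⟩, q, hq, fun n => ⟨i + n * p, ?_, ?_⟩⟩,
    i, p, hp, fun n hn => ?_⟩
  · simpa [hσ k] using hr (σ k)
  · nlinarith
  · simp [σ, hi]
  · have h1 : ¬ n < i := by lia
    have h2 : ¬ n + p < i := by lia
    simp only [Function.comp, σ, h1, h2, if_false]
    rw [show n + p - i = n - i + p by lia, Nat.add_mod_right]

theorem abBlocks_succ {A : Type*} (a b : A) (m : ℕ) : abBlocks a b (m + 1) =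
    abBlocks a b m ++ (List.replicate (m + 1) a ++ List.replicate (m + 1) b) := by
  simp [abBlocks, List.range_succ]

theorem getElem?_abBlocks {A : Type*} (a b : A) {m M n : ℕ} (h : m ≤ M) (hn : n < m * (m + 1)) :
    (abBlocks a b M)[n]? = (abBlocks a b m)[n]? := by
  induction M, h using Nat.le_induction with
  | base => rfl
  | succ M hM ih =>
    rw [abBlocks_succ, List.getElem?_append_left, ih]
    rw [length_abBlocks]
    nlinarith

theorem abWord_eq_getElem? {A : Type*} (a b : A) {m n : ℕ} (hn : n < m * (m + 1)) :
    some (abWord a b n) = (abBlocks a b m)[n]? := by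
  have h : some (abWord a b n) = (abBlocks a b (n + 1))[n]? := by
    rw [abWord, List.getElem?_eq_getElem]
  rw [h]
  rcases le_total m (n + 1) with hm | hm
  · exact getElem?_abBlocks a b hm hn
  · exact (getElem?_abBlocks a b hm (by nlinarith)).symm

theorem abWord_left {A : Type*} (a b : A) {m j : ℕ} (hj : j ≤ m) :
    abWord a b (m * (m + 1) + j) = a := by
  have h := abWord_eq_getElem? a b (m := m + 1) (n := m * (m + 1) + j) (by nlinarith)
  rw [abBlocks_succ, List.getElem?_append_right (by simp [length_abBlocks]), length_abBlocks,
    Nat.add_sub_cancel_left, List.getElem?_append_left (by simp; lia)] at h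
  simpa [Nat.lt_succ_iff.2 hj] using h

theorem abWord_right {A : Type*} (a b : A) {m j : ℕ} (hj : j ≤ m) :
    abWord a b (m * (m + 1) + (m + 1 + j)) = b := by
  have h := abWord_eq_getElem? a b (m := m + 1) (n := m * (m + 1) + (m + 1 + j)) (by nlinarith)
  rw [abBlocks_succ, List.getElem?_append_right (by simp [length_abBlocks]), length_abBlocks,
    Nat.add_sub_cancel_left, List.getElem?_append_right (by simp)] at h
  simpa [Nat.lt_succ_iff.2 hj] using h

theorem not_ultimatelyPeriodic_abWord {A : Type*} {a b : A} (hab : a ≠ b) :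
    ¬ UltimatelyPeriodic (abWord a b) := by
  rintro ⟨N, p, hp, h⟩
  -- This is the last `a` of a block of length `N + p + 1`; moving on by `p` lands inside the
  -- equally long block of `b`.
  have h1 := h ((N + p) * (N + p + 1) + (N + p)) (by nlinarith)
  rw [abWord_left a b le_rfl, show (N + p) * (N + p + 1) + (N + p) + p =
    (N + p) * (N + p + 1) + (N + p + 1 + (p - 1)) by lia, abWord_right a b (by lia)] at h1
  exact hab h1.symm

theorem singleton_not_mem_probable {A : Type*} {w : ℕ → A} (hw : ¬ UltimatelyPeriodic w) :
    ({w} : Set (ℕ → A)) ∉ Probable A := by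
  let : TopologicalSpace A := ⊥
  have : DiscreteTopology A := ⟨rfl⟩
  intro h
  have h1 := closure_mem_omegaRegular h
  rw [closure_singleton] at h1
  obtain ⟨v, rfl, hv⟩ := exists_ultimatelyPeriodic_of_omegaRegular h1 (singleton_nonempty w)
  exact hw hv

theorem singleton_mem_BClGδ {A : Type*} [TopologicalSpace A] [DiscreteTopology A] (w : ℕ → A) :
    ({w} : Set (ℕ → A)) ∈ BClGδ A := by
  have h : ({w}ᶜ : Set (ℕ → A)) ∈ BooleanSubalgebra.closure {L : Set (ℕ → A) | IsGδ L} :=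
    BooleanSubalgebra.subset_closure isOpen_compl_singleton.isGδ
  have h' := BooleanSubalgebra.compl_mem h
  rwa [compl_compl] at h'

/-! ### ω-regular languages are probable: breakpoints and semi-determinization. -/

section Reach

variable {A Q : Type*} {T : Set (Q × A × Q)}

theorem reach_mono {X Y : Set Q} (h : X ⊆ Y) (w : ℕ → A) (k : ℕ) :
    reach T X w k ⊆ reach T Y w k := by
  induction k with
  | zero => exact h
  | succ k ih => rintro x ⟨y, hy, ht⟩; exact ⟨y, ih hy, ht⟩

theorem reach_add (X : Set Q) (w : ℕ → A) (m k : ℕ) :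
    reach T X w (m + k) = reach T (reach T X w m) (dropSeq m w) k := by
  induction k with
  | zero => rfl
  | succ k ih => rw [← add_assoc, reach, ih, reach, dropSeq_apply]

theorem nonempty_reach_of_le {X : Set Q} {w : ℕ → A} {k m : ℕ} (hkm : k ≤ m)
    (h : (reach T X w m).Nonempty) : (reach T X w k).Nonempty := by
  induction m, hkm using Nat.le_induction with
  | base => exact h
  | succ m _ ih =>
    obtain ⟨x, y, hy, -⟩ := h
    exact ih ⟨y, hy⟩

theorem mem_reach_of_run {r : ℕ → Q} {w : ℕ → A} (h : ∀ i, (r i, w i, r (i + 1)) ∈ T) (k : ℕ) :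
    r k ∈ reach T {r 0} w k := by
  induction k with
  | zero => rfl
  | succ k ih => exact ⟨r k, ih, h k⟩

theorem reach_run_subset {r : ℕ → Q} {w : ℕ → A} (h : ∀ i, (r i, w i, r (i + 1)) ∈ T) (m k : ℕ) :
    reach T {r m} (dropSeq m w) k ⊆ reach T {r 0} w (m + k) := by
  rw [reach_add]
  exact reach_mono (singleton_subset_iff.2 (mem_reach_of_run h m)) _ _

/-- Along a run, the sets of reachable states started at late positions eventually merge. -/
theorem exists_reach_eq [Finite Q] {r : ℕ → Q} {w : ℕ → A}
    (h : ∀ i, (r i, w i, r (i + 1)) ∈ T) :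
    ∃ n, ∀ m, ∃ k, reach T {r n} (dropSeq n w) (m + k) =
      reach T {r (n + m)} (dropSeq (n + m) w) k := by
  by_contra! hc
  -- Each failure to merge is a strict inclusion at every later time, so moving the start lowers the
  -- bound on the cardinalities by one; this cannot happen more than `Nat.card Q` times.
  have key : ∀ j, ∃ n, ∀ k, j + (reach T {r n} (dropSeq n w) k).ncard ≤ Nat.card Q := by
    intro j
    induction j with
    | zero => exact ⟨0, fun k => by simpa using Set.ncard_le_card _⟩
    | succ j ih =>
      obtain ⟨n, hn⟩ := ih
      obtain ⟨m, hm⟩ := hc n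
      refine ⟨n + m, fun k => ?_⟩
      have hsub : reach T {r (n + m)} (dropSeq (n + m) w) k ⊂
          reach T {r n} (dropSeq n w) (m + k) := by
        refine LE.le.ssubset_of_ne ?_ (hm k).symm
        have := reach_run_subset (r := dropSeq n r) (w := dropSeq n w)
          (fun i => h (n + i)) m k
        rwa [dropSeq_dropSeq] at this
      have := Set.ncard_lt_ncard hsub (Set.toFinite _)
      have := hn (m + k)
      lia
  obtain ⟨n, hn⟩ := key (Nat.card Q + 1)
  have := hn 0
  lia

end Reach

section Breakpoint

variable {A Q : Type*}

open Classical in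
/-- A step of the breakpoint construction: the first component follows all runs, the second one
those that have visited `F` since the last time the two components were equal. -/
noncomputable def breakStep (T : Set (Q × A × Q)) (F : Set Q) (a : A) (s : Set Q × Set Q) :
    Set Q × Set Q :=
  ({x | ∃ y ∈ s.1, (y, a, x) ∈ T},
    {x | ∃ y ∈ if s.2 = s.1 then ∅ else s.2, (y, a, x) ∈ T} ∪ {x | ∃ y ∈ s.1, (y, a, x) ∈ T} ∩ F)

/-- The run of the breakpoint construction. -/
noncomputable def breakSeq (T : Set (Q × A × Q)) (F : Set Q) (s : Set Q × Set Q) (w : ℕ → A) :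
    ℕ → Set Q × Set Q
  | 0 => s
  | k + 1 => breakStep T F (w k) (breakSeq T F s w k)

/-- The breakpoints: both components are equal and nonempty. -/
def IsBreak (s : Set Q × Set Q) : Prop := s.2 = s.1 ∧ s.1.Nonempty

variable {T : Set (Q × A × Q)} {F : Set Q}

theorem breakSeq_succ' (s : Set Q × Set Q) (w : ℕ → A) (k : ℕ) :
    breakSeq T F s w (k + 1) = breakSeq T F (breakStep T F (w 0) s) (dropSeq 1 w) k := by
  induction k with
  | zero => rfl
  | succ k ih => rw [breakSeq, ih, breakSeq, dropSeq_apply, add_comm k 1]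

theorem breakSeq_fst (s : Set Q × Set Q) (w : ℕ → A) (k : ℕ) :
    (breakSeq T F s w k).1 = reach T s.1 w k := by
  induction k with
  | zero => rfl
  | succ k ih => rw [reach, ← ih]; rfl

theorem breakSeq_snd_subset {s : Set Q × Set Q} (hs : s.2 ⊆ s.1) (w : ℕ → A) (k : ℕ) :
    (breakSeq T F s w k).2 ⊆ (breakSeq T F s w k).1 := by
  induction k with
  | zero => exact hs
  | succ k ih =>
    rintro x (⟨y, hy, ht⟩ | ⟨hx, -⟩)
    · split_ifs at hy with h
      · exact absurd hy (notMem_empty _)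
      · exact ⟨y, ih hy, ht⟩
    · exact hx

/-- There is a run from `q` on `w` that visits `F` infinitely often. -/
def HasBuchiRun (T : Set (Q × A × Q)) (F : Set Q) (q : Q) (w : ℕ → A) : Prop :=
  ∃ r : ℕ → Q, r 0 = q ∧ (∀ i, (r i, w i, r (i + 1)) ∈ T) ∧ ∀ n, ∃ i, n ≤ i ∧ r i ∈ F

theorem HasBuchiRun.cons {q q' : Q} {w : ℕ → A} (ht : (q, w 0, q') ∈ T)
    (h : HasBuchiRun T F q' (dropSeq 1 w)) : HasBuchiRun T F q w := by
  obtain ⟨r, rfl, hr, hF⟩ := h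
  refine ⟨fun i => Nat.casesOn i q r, rfl, fun i => ?_, fun n => ?_⟩
  · cases i with
    | zero => exact ht
    | succ i => simpa [add_comm 1 i] using hr i
  · obtain ⟨i, hi, h⟩ := hF n
    exact ⟨i + 1, by lia, h⟩

theorem BuchiAutomaton.mem_language_iff [Finite Q] (M : BuchiAutomaton A Q) (w : ℕ → A) :
    w ∈ M.language ↔ HasBuchiRun M.trans M.final M.init w := by
  constructor
  · rintro ⟨r, ⟨h0, hr⟩, q, hq, hinf⟩
    refine ⟨r, h0, hr, fun n => ?_⟩
    obtain ⟨i, hi, rfl⟩ := hinf n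
    exact ⟨i, hi, hq⟩
  · rintro ⟨r, h0, hr, hF⟩
    have hinf : {i | r i ∈ M.final}.Infinite :=
      Set.infinite_of_not_bddAbove fun ⟨n, hn⟩ => by
        obtain ⟨i, hi, h⟩ := hF (n + 1)
        have := hn h
        lia
    have : Infinite {i | r i ∈ M.final} := hinf.to_subtype
    obtain ⟨q, hq⟩ := Finite.exists_infinite_fiber
      (fun i : {i | r i ∈ M.final} => (⟨r i, i.2⟩ : M.final))
    rw [Set.infinite_coe_iff] at hq
    refine ⟨r, ⟨h0, hr⟩, q, q.2, fun n => ?_⟩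
    obtain ⟨i, hi, hn⟩ := (hq.image (f := Subtype.val) Subtype.val_injective.injOn).exists_gt n
    obtain ⟨j, hj, rfl⟩ := hi
    exact ⟨j, hn.le, congrArg Subtype.val hj⟩

/-- König's lemma is applied with predecessors chosen so that a state in the second component comes
from one there, with no reset in between, unless it lies in `F`. A breakpoint empties the second
component before the next step and the following breakpoint has the run inside it, so the run meets
`F` in between. -/
theorem hasBuchiRun_of_isBreak [Finite Q] {q : Q} {w : ℕ → A}
    (h : ∀ n, ∃ k, n ≤ k ∧ IsBreak (breakSeq T F ({q}, ∅) w k)) : HasBuchiRun T F q w := by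
  set d := breakSeq T F ({q}, ∅) w with hd
  obtain ⟨r, hr⟩ := exists_seq_of_forall_exists_pred (fun k => (d k).1)
    (fun k y x => (y, w k, x) ∈ T ∧ (x ∈ (d (k + 1)).2 → x ∈ F ∨ y ∈ (d k).2 ∧ (d k).2 ≠ (d k).1))
    (fun k => by
      obtain ⟨m, hm, -, hne⟩ := h k
      rw [hd, breakSeq_fst] at hne ⊢
      exact nonempty_reach_of_le hm hne)
    (fun k x hx => by
      by_cases hx2 : x ∈ (d (k + 1)).2
      · rcases hx2 with ⟨y, hy, ht⟩ | ⟨⟨y, hy, ht⟩, hF⟩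
        · split_ifs at hy with he
          · exact absurd hy (notMem_empty _)
          · exact ⟨y, breakSeq_snd_subset (empty_subset _) w k hy, ht, fun _ => Or.inr ⟨hy, he⟩⟩
        · exact ⟨y, hy, ht, fun _ => Or.inl hF⟩
      · obtain ⟨y, hy, ht⟩ := hx
        exact ⟨y, hy, ht, fun h => absurd h hx2⟩)
  refine ⟨r, (hr 0).1, fun i => (hr i).2.1, fun n => ?_⟩
  by_contra! hc
  obtain ⟨k, hnk, hk, -⟩ := h n
  obtain ⟨m, hkm, hm, -⟩ := h (k + 1)
  have key : ∀ j, r (k + j + 1) ∉ (d (k + j + 1)).2 := by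
    intro j
    induction j with
    | zero =>
      intro hj
      rcases (hr k).2.2 hj with h | h
      · exact hc _ (by lia) h
      · exact h.2 hk
    | succ j ih =>
      intro hj
      rcases (hr _).2.2 hj with h | h
      · exact hc _ (by lia) h
      · exact ih h.1
  obtain ⟨j, rfl⟩ := Nat.exists_eq_add_of_le hkm
  refine key j ?_
  rw [show k + j + 1 = k + 1 + j by lia, hm]
  exact (hr _).1

/-- Without breakpoints after `n` the second component is never reset, so it retains all descendants
of a later visit `r m` to `F`. By the merging hypothesis these descendants eventually fill the first
component, which is a breakpoint. -/
theorem exists_isBreak_of_reach_eq {r : ℕ → Q} {w : ℕ → A} (h : ∀ i, (r i, w i, r (i + 1)) ∈ T)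
    (hF : ∀ n, ∃ i, n ≤ i ∧ r i ∈ F)
    (hm : ∀ m, ∃ k, reach T {r 0} w (m + k) = reach T {r m} (dropSeq m w) k) (n : ℕ) :
    ∃ k, n ≤ k ∧ IsBreak (breakSeq T F ({r 0}, ∅) w k) := by
  by_contra! hc
  set d := breakSeq T F ({r 0}, ∅) w with hd
  have hd1 : ∀ k, (d k).1 = reach T {r 0} w k := breakSeq_fst _ _
  have hrd : ∀ k, r k ∈ (d k).1 := fun k => by
    rw [hd1]
    exact mem_reach_of_run h k
  have hne : ∀ k, n ≤ k → (d k).2 ≠ (d k).1 := fun k hk he => hc k hk ⟨he, _, hrd k⟩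
  obtain ⟨m, hnm, hmF⟩ := hF (n + 1)
  have key : ∀ k, reach T {r m} (dropSeq m w) k ⊆ (d (m + k)).2 := by
    intro k
    induction k with
    | zero =>
      obtain ⟨m, rfl⟩ := Nat.exists_eq_add_of_le' (show 1 ≤ m by lia)
      exact singleton_subset_iff.2 (Or.inr ⟨hrd (m + 1), hmF⟩)
    | succ k ih =>
      rintro x ⟨y, hy, ht⟩
      refine Or.inl ⟨y, ?_, ht⟩
      exact (if_neg (hne (m + k) (by lia))).symm ▸ ih hy
  obtain ⟨k, hk⟩ := hm m
  refine hne (m + k) (by lia) (subset_antisymm (breakSeq_snd_subset (empty_subset _) w _) ?_)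
  rw [hd1, hk]
  exact key k

theorem exists_isBreak_of_run [Finite Q] {r : ℕ → Q} {w : ℕ → A}
    (h : ∀ i, (r i, w i, r (i + 1)) ∈ T) (hF : ∀ n, ∃ i, n ≤ i ∧ r i ∈ F) :
    ∃ m, ∀ n, ∃ k, n ≤ k ∧ IsBreak (breakSeq T F ({r m}, ∅) (dropSeq m w) k) := by
  obtain ⟨m, hm⟩ := exists_reach_eq h
  refine ⟨m, exists_isBreak_of_reach_eq (r := dropSeq m r) (fun i => h (m + i)) (fun n => ?_)
    fun j => ?_⟩
  · obtain ⟨i, hi, hF⟩ := hF (m + n)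
    exact ⟨i - m, by lia, by simpa [show m + (i - m) = i by lia] using hF⟩
  · rw [dropSeq_dropSeq]
    exact hm j

end Breakpoint

namespace PBA

variable {A P : Type*} [Fintype P]

open Classical in
/-- The automaton that moves to a uniformly chosen element of a nonempty set of successors. -/
noncomputable def ofSucc (init : P) (final : Set P) (succ : P → A → Set P)
    (h : ∀ p a, (succ p a).Nonempty) : PBA A P where
  init := init
  final := final
  δ p a p' := if p' ∈ succ p a then ((succ p a).toFinset.card : ℝ≥0)⁻¹ else 0
  sum_δ p a := by
    have : (succ p a).toFinset.card ≠ 0 :=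
      Finset.card_ne_zero.2 (Set.toFinset_nonempty.2 (h p a))
    rw [← Finset.sum_filter, Finset.sum_const, nsmul_eq_mul]
    have hf : (Finset.univ.filter fun p' => p' ∈ succ p a) = (succ p a).toFinset := by
      ext; simp
    rw [hf, mul_inv_cancel₀]
    exact_mod_cast this

theorem ofSucc_δ_ne_zero {init : P} {final : Set P} {succ : P → A → Set P}
    {h : ∀ p a, (succ p a).Nonempty} {p p' : P} {a : A} :
    (ofSucc init final succ h).δ p a p' ≠ 0 ↔ p' ∈ succ p a := by
  classical
  have : ((succ p a).toFinset.card : ℝ≥0) ≠ 0 :=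
    Nat.cast_ne_zero.2 (Finset.card_ne_zero.2 (Set.toFinset_nonempty.2 (h p a)))
  simp only [ofSucc]
  split_ifs with hm
  · exact iff_of_true (inv_ne_zero this) hm
  · exact iff_of_false (fun h => h rfl) hm

end PBA

section SemiDeterminization

variable {A : Type*} {Q : Type} (M : BuchiAutomaton A Q)

/-- The successors in the semi-deterministic automaton: either follow the given automaton or
start the breakpoint construction. -/
def semiSucc : Q ⊕ (Set Q × Set Q) → A → Set (Q ⊕ (Set Q × Set Q))
  | .inl q, a => {p | p = .inr (breakStep M.trans M.final a ({q}, ∅)) ∨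
      ∃ q', (q, a, q') ∈ M.trans ∧ p = .inl q'}
  | .inr s, a => {.inr (breakStep M.trans M.final a s)}

theorem semiSucc_nonempty (p : Q ⊕ (Set Q × Set Q)) (a : A) : (semiSucc M p a).Nonempty := by
  cases p with
  | inl q => exact ⟨_, Or.inl rfl⟩
  | inr s => exact ⟨_, rfl⟩

/-- The probabilistic automaton of the semi-deterministic automaton. -/
noncomputable def semiPBA [Fintype (Q ⊕ (Set Q × Set Q))] : PBA A (Q ⊕ (Set Q × Set Q)) :=
  .ofSucc (.inl M.init) {p | ∃ s, p = .inr s ∧ IsBreak s} (semiSucc M) (semiSucc_nonempty M)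

variable [Fintype (Q ⊕ (Set Q × Set Q))]

theorem semiPBA_run_inr {r : ℕ → Q ⊕ (Set Q × Set Q)} {w : ℕ → A} {s : Set Q × Set Q}
    (h0 : r 0 = .inr s) (h : ∀ k, (semiPBA M).δ (r k) (w k) (r (k + 1)) ≠ 0) (k : ℕ) :
    r k = .inr (breakSeq M.trans M.final s w k) := by
  induction k with
  | zero => exact h0
  | succ k ih =>
    have := PBA.ofSucc_δ_ne_zero.1 (h k)
    rw [ih] at this
    exact this

theorem hasBuchiRun_of_semiPBA_run [Finite Q] (n : ℕ) {r : ℕ → Q ⊕ (Set Q × Set Q)} {w : ℕ → A}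
    {q : Q} (h0 : r 0 = .inl q) (h : ∀ k, (semiPBA M).δ (r k) (w k) (r (k + 1)) ≠ 0)
    (hr : r ∈ (semiPBA M).acceptingRuns) (hn : ∃ s, r n = .inr s) :
    HasBuchiRun M.trans M.final q w := by
  induction n generalizing r w q with
  | zero =>
    obtain ⟨s, hs⟩ := hn
    rw [h0] at hs
    exact absurd hs (by simp)
  | succ n ih =>
    have hr' : dropSeq 1 r ∈ (semiPBA M).acceptingRuns := by
      rwa [← mem_preimage, PBA.preimage_dropSeq_acceptingRuns]
    have h' : ∀ k, (semiPBA M).δ (dropSeq 1 r k) (dropSeq 1 w k) (dropSeq 1 r (k + 1)) ≠ 0 :=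
      fun k => h (1 + k)
    have h1 := PBA.ofSucc_δ_ne_zero.1 (h 0)
    rw [h0] at h1
    rcases h1 with h1 | ⟨q', ht, h1⟩
    -- The jump already performs one breakpoint step from `({q}, ∅)`, hence the shift by one.
    · refine hasBuchiRun_of_isBreak fun n => ?_
      obtain ⟨i, hi, s, hs, hb⟩ := hr' n
      have := semiPBA_run_inr M (r := dropSeq 1 r) h1 h' i
      rw [hs, Sum.inr.injEq, ← breakSeq_succ'] at this
      exact ⟨i + 1, by lia, this ▸ hb⟩
    · refine HasBuchiRun.cons ht (ih h1 h' hr' ?_)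
      obtain ⟨s, hs⟩ := hn
      exact ⟨s, by simpa [add_comm] using hs⟩

variable [MeasurableSpace (Q ⊕ (Set Q × Set Q))] [DiscreteMeasurableSpace (Q ⊕ (Set Q × Set Q))]

/-- After the jump the automaton is deterministic, so almost every run is the breakpoint run. -/
theorem semiPBA_val_inr {s : Set Q × Set Q} {w : ℕ → A}
    (h : ∀ n, ∃ k, n ≤ k ∧ IsBreak (breakSeq M.trans M.final s w k)) :
    (semiPBA M).val (.inr s) w = 1 := by
  refine (prob_compl_eq_zero_iff (PBA.measurableSet_acceptingRuns _)).1 ?_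
  refine (ae_iff (p := fun r => r ∈ (semiPBA M).acceptingRuns)).1 ?_
  filter_upwards [PBA.ae_law_δ_ne_zero (semiPBA M) (.inr s) w] with r hr n
  obtain ⟨k, hk, hb⟩ := h n
  exact ⟨k, hk, _, semiPBA_run_inr M hr.1 hr.2 k, hb⟩

theorem semiPBA_probableLanguage [Finite Q] : (semiPBA M).probableLanguage = M.language := by
  ext w
  rw [PBA.mem_probableLanguage_iff, M.mem_language_iff]
  constructor
  · intro h
    obtain ⟨r, hr, h0, hδ⟩ : ∃ r ∈ (semiPBA M).acceptingRuns, r 0 = .inl M.init ∧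
        ∀ k, (semiPBA M).δ (r k) (w k) (r (k + 1)) ≠ 0 := by
      by_contra! hc
      refine h.ne' ?_
      refine measure_mono_null (fun r hr => ?_) (PBA.ae_law_δ_ne_zero (semiPBA M) _ w)
      rintro ⟨h0, h1⟩
      obtain ⟨k, hk⟩ := hc r hr h0
      exact h1 k hk
    obtain ⟨n, -, s, hs, -⟩ := hr 0
    exact hasBuchiRun_of_semiPBA_run M n h0 hδ hr ⟨s, hs⟩
  · rintro ⟨r, h0, hr, hF⟩
    obtain ⟨m, hm⟩ := exists_isBreak_of_run hr hF
    change 0 < (semiPBA M).val (.inl M.init) w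
    rw [← h0]
    refine PBA.val_pos_of_path (semiPBA M) m (r := fun k => .inl (r k)) (fun i _ => ?_) ?_
    · exact PBA.ofSucc_δ_ne_zero.2 (Or.inr ⟨_, hr i, rfl⟩)
    · refine PBA.val_pos_of_step (semiPBA M)
        (x := .inr (breakStep M.trans M.final (dropSeq m w 0) ({r m}, ∅)))
        (PBA.ofSucc_δ_ne_zero.2 (Or.inl rfl)) ?_
      rw [semiPBA_val_inr]
      · exact zero_lt_one
      · intro n
        obtain ⟨k, hk, hb⟩ := hm (n + 1)
        obtain ⟨k, rfl⟩ := Nat.exists_eq_add_of_le' (show 1 ≤ k by lia)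
        rw [breakSeq_succ'] at hb
        exact ⟨k, by lia, hb⟩

end SemiDeterminization

theorem omegaRegular_subset_probable (A : Type*) : OmegaRegular A ⊆ Probable A := by
  rintro _ ⟨Q, _, M, rfl⟩
  let _ : Fintype (Q ⊕ (Set Q × Set Q)) := Fintype.ofFinite _
  let _ : MeasurableSpace (Q ⊕ (Set Q × Set Q)) := ⊤
  have : DiscreteMeasurableSpace (Q ⊕ (Set Q × Set Q)) := ⟨fun _ => trivial⟩
  exact ⟨_, inferInstance, inferInstance, inferInstance, semiPBA M,
    (semiPBA_probableLanguage M).symm⟩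

/-! ### A probable language that is not ω-regular. -/

namespace PBA

section Subharmonic

variable {A Q : Type*} [Fintype Q] [MeasurableSpace Q] [DiscreteMeasurableSpace Q]

/-- A subharmonic function that vanishes outside `G` bounds the probability to stay in `G`. -/
theorem ofReal_le_law_forall_mem (B : PBA A Q) (w : ℕ → A) (G : Set Q) (h : ℕ → Q → ℝ)
    (h0 : ∀ n x, 0 ≤ h n x) (h1 : ∀ n x, h n x ≤ 1) (hG : ∀ n, ∀ x ∉ G, h n x = 0)
    (hsub : ∀ n, ∀ x ∈ G, h n x ≤ ∑ y, (B.δ x (w n) y : ℝ) * h (n + 1) y) (x : Q) :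
    ENNReal.ofReal (h 0 x) ≤ B.law x w {r | ∀ k, r k ∈ G} := by
  have hm : ∀ m, MeasurableSet {r : ℕ → Q | ∀ k ≤ m, r k ∈ G} := by
    intro m
    have := measurableSet_forall_mem fun k => {q : Q | k ≤ m → q ∈ G}
    exact this
  -- Induction on the horizon `m`, with the starting time `n` free because the first step shifts it.
  have key : ∀ m n x, ENNReal.ofReal (h n x) ≤
      B.law x (dropSeq n w) {r | ∀ k ≤ m, r k ∈ G} := by
    intro m
    induction m with
    | zero =>
      intro n x
      by_cases hx : x ∈ G
      · have : ∀ᵐ r ∂(B.law x (dropSeq n w)), r ∈ {r : ℕ → Q | ∀ k ≤ 0, r k ∈ G} := by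
          filter_upwards [B.ae_law_zero x (dropSeq n w)] with r hr k hk
          rw [Nat.le_zero.1 hk, hr]
          exact hx
        rw [(prob_compl_eq_zero_iff (hm 0)).1 this]
        simpa using h1 n x
      · simp [hG n x hx]
    | succ m ih =>
      intro n x
      by_cases hx : x ∈ G
      · have : B.law x (dropSeq n w) {r | ∀ k ≤ m + 1, r k ∈ G} =
            B.law x (dropSeq n w) (dropSeq 1 ⁻¹' {r | ∀ k ≤ m, r k ∈ G}) := by
          refine measure_congr ?_
          filter_upwards [B.ae_law_zero x (dropSeq n w)] with r hr
          refine propext ⟨fun h k hk => h (1 + k) (by lia), fun h k hk => ?_⟩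
          rcases Nat.eq_zero_or_pos k with rfl | hk0
          · rwa [hr]
          · have := h (k - 1) (by lia)
            rwa [dropSeq_apply, show 1 + (k - 1) = k by lia] at this
        rw [this, law_dropSeq_one _ _ _ (hm m), dropSeq_dropSeq]
        refine (ENNReal.ofReal_le_ofReal (hsub n x hx)).trans ?_
        rw [ENNReal.ofReal_sum_of_nonneg fun y _ => mul_nonneg (NNReal.coe_nonneg _) (h0 _ _)]
        refine Finset.sum_le_sum fun y _ => ?_
        rw [ENNReal.ofReal_mul (NNReal.coe_nonneg _), ENNReal.ofReal_coe_nnreal, dropSeq_apply,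
          add_zero]
        gcongr
        exact ih (n + 1) y
      · simp [hG n x hx]
  have hi : {r : ℕ → Q | ∀ k, r k ∈ G} = ⋂ m, {r | ∀ k ≤ m, r k ∈ G} := by
    ext r
    simp only [mem_ofPred_eq, mem_iInter]
    exact ⟨fun h _ k _ => h k, fun h k => h k k le_rfl⟩
  have ha : Antitone fun m => {r : ℕ → Q | ∀ k ≤ m, r k ∈ G} :=
    fun m m' hmm r hr k hk => hr k (hk.trans hmm)
  rw [hi, ha.measure_iInter (fun m => (hm m).nullMeasurableSet) ⟨0, measure_ne_top _ _⟩]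
  refine le_iInf fun m => ?_
  simpa using key m 0 x

end Subharmonic

section Block

variable {A : Type*}

open Classical in
/-- In the state `0` every letter different from `b` leads to the state `1` with probability one
half; the letter `b` leads from `1` to `0` and from `0` to the absorbing state `2`. -/
noncomputable def blockPBA (b : A) : PBA A (Fin 3) where
  init := 1
  final := {0}
  δ q c := if c = b then ![![0, 0, 1], ![1, 0, 0], ![0, 0, 1]] q
    else ![![2⁻¹, 2⁻¹, 0], ![0, 1, 0], ![0, 0, 1]] q
  sum_δ q a := by
    have h2 : (2⁻¹ + 2⁻¹ : ℝ≥0) = 1 := by rw [← two_mul, mul_inv_cancel₀ two_ne_zero]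
    split_ifs <;> fin_cases q <;> simp [Fin.sum_univ_three, h2]

variable {b : A}

theorem blockPBA_val_two (w : ℕ → A) : (blockPBA b).val 2 w = 0 := by
  refine measure_mono_null (fun r hr => ?_) ((blockPBA b).ae_law_δ_ne_zero 2 w)
  rintro ⟨h0, h⟩
  have h2 : ∀ k, r k = 2 := by
    intro k
    induction k with
    | zero => exact h0
    | succ k ih =>
      have := h k
      rw [ih] at this
      generalize r (k + 1) = x at this
      by_contra hx
      refine this ?_
      fin_cases x <;> simp_all [blockPBA]
  obtain ⟨i, -, hi⟩ := hr 0
  have hi : r i = 0 := hi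
  rw [h2] at hi
  exact absurd hi (by decide)

theorem blockPBA_val_one_of_forall_ne {w : ℕ → A} (hw : ∀ k, w k ≠ b) :
    (blockPBA b).val 1 w = 0 := by
  refine measure_mono_null (fun r hr => ?_) ((blockPBA b).ae_law_δ_ne_zero 1 w)
  rintro ⟨h0, h⟩
  have h2 : ∀ k, r k = 1 := by
    intro k
    induction k with
    | zero => exact h0
    | succ k ih =>
      have := h k
      rw [ih] at this
      generalize r (k + 1) = x at this
      by_contra hx
      refine this ?_
      have := hw k
      fin_cases x <;> simp_all [blockPBA]
  obtain ⟨i, -, hi⟩ := hr 0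
  have hi : r i = 0 := hi
  rw [h2] at hi
  exact absurd hi (by decide)

theorem blockPBA_val_zero_of_eq {w : ℕ → A} (hw : w 0 = b) : (blockPBA b).val 0 w = 0 := by
  rw [val_eq_sum, Fin.sum_univ_three, blockPBA_val_two]
  simp [blockPBA, hw]

theorem blockPBA_val_zero_of_ne {w : ℕ → A} (hw : w 0 ≠ b) : (blockPBA b).val 0 w =
    2⁻¹ * (blockPBA b).val 0 (dropSeq 1 w) + 2⁻¹ * (blockPBA b).val 1 (dropSeq 1 w) := by
  rw [val_eq_sum, Fin.sum_univ_three, blockPBA_val_two]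
  simp [blockPBA, hw]

/-- With probability at least `2⁻¹ ^ k` the chain has not left state `0` when some `b` at or before
position `k` arrives, and is then absorbed in `2`. -/
theorem blockPBA_val_zero_add_le (k : ℕ) {w : ℕ → A} (hw : w k = b) :
    (blockPBA b).val 0 w + 2⁻¹ ^ k ≤ 1 := by
  induction k generalizing w with
  | zero => simp [blockPBA_val_zero_of_eq hw]
  | succ k ih =>
    by_cases h0 : w 0 = b
    · rw [blockPBA_val_zero_of_eq h0, zero_add]
      exact pow_le_one₀ (by simp) (by simp)
    · have h1 := ih (w := dropSeq 1 w) (by rwa [dropSeq_apply, add_comm])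
      have h2 := (blockPBA b).val_le_one 1 (dropSeq 1 w)
      calc (blockPBA b).val 0 w + 2⁻¹ ^ (k + 1)
          = 2⁻¹ * ((blockPBA b).val 0 (dropSeq 1 w) + 2⁻¹ ^ k) +
            2⁻¹ * (blockPBA b).val 1 (dropSeq 1 w) := by
            rw [blockPBA_val_zero_of_ne h0]; ring
        _ ≤ 2⁻¹ * 1 + 2⁻¹ * 1 := by gcongr
        _ = 1 := by rw [mul_one, ENNReal.inv_two_add_inv_two]

theorem blockPBA_val_zero_add_le_of_forall_ne {w : ℕ → A} (hw : ∀ k, w k ≠ b) :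
    (blockPBA b).val 0 w + 2⁻¹ ≤ 1 := by
  rw [blockPBA_val_zero_of_ne (hw 0),
    blockPBA_val_one_of_forall_ne (w := dropSeq 1 w) fun k => hw (1 + k), mul_zero, add_zero]
  calc _ ≤ (2⁻¹ : ℝ≥0∞) * 1 + 2⁻¹ := by gcongr; exact val_le_one _ _ _
    _ = 1 := by rw [mul_one, ENNReal.inv_two_add_inv_two]

/-- On the periodic part the value of state `0` stays below one by the fixed amount `2⁻¹ ^ p`,
whether or not the period contains `b`. An accepting run visits `0` infinitely often, while Lévy's
law makes the values along it tend to one. -/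
theorem not_ultimatelyPeriodic_of_mem_blockPBA {w : ℕ → A}
    (hw : w ∈ (blockPBA b).probableLanguage) : ¬ UltimatelyPeriodic w := by
  rintro ⟨N, p, hp, h⟩
  have hmul : ∀ j n, N ≤ n → w (n + j * p) = w n := by
    intro j n hn
    induction j with
    | zero => simp
    | succ j ih => rw [← ih, ← h (n + j * p) (by lia)]; congr 1; ring
  have hle : ∀ n, N ≤ n → (blockPBA b).val 0 (dropSeq n w) + 2⁻¹ ^ p ≤ 1 := by
    intro n hn
    by_cases hb : ∃ k < p, w (n + k) = b
    · obtain ⟨k, hk, hb⟩ := hb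
      refine le_trans ?_ (blockPBA_val_zero_add_le (b := b) k (w := dropSeq n w) hb)
      gcongr 1
      exact pow_le_pow_of_le_one zero_le (by simp) hk.le
    · push Not at hb
      refine le_trans ?_ (blockPBA_val_zero_add_le_of_forall_ne (b := b) (w := dropSeq n w) ?_)
      · gcongr 1
        exact pow_le_of_le_one (by simp) (by simp) hp.ne'
      · intro k
        have := hb (k % p) (Nat.mod_lt _ hp)
        rwa [← hmul (k / p) _ (by lia), show n + k % p + k / p * p = n + k by
          rw [add_assoc, mul_comm, Nat.mod_add_div]] at this
  rw [mem_probableLanguage_iff] at hw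
  refine hw.ne' (measure_mono_null (fun r hr => ?_)
    ((blockPBA b).ae_tendsto_val (blockPBA b).init w))
  intro ht
  have ht : Filter.Tendsto (fun n => ((blockPBA b).val (r n) (dropSeq n w)).toReal) Filter.atTop
    (nhds ((blockPBA b).acceptingRuns.indicator (fun _ => (1 : ℝ)) r)) := ht
  rw [indicator_of_mem hr] at ht
  have hlt : (1 : ℝ) - 2⁻¹ ^ p < 1 := by
    have : (0 : ℝ) < 2⁻¹ ^ p := by positivity
    linarith
  obtain ⟨M, hM⟩ := Filter.eventually_atTop.1 (ht.eventually (lt_mem_nhds hlt))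
  obtain ⟨i, hi, hri⟩ := hr (max M N)
  have hri : r i = 0 := hri
  have h1 := hM i ((le_max_left _ _).trans hi)
  have h2 := ENNReal.toReal_mono ENNReal.one_ne_top (hle i ((le_max_right _ _).trans hi))
  rw [ENNReal.toReal_add ((val_le_one _ _ _).trans_lt ENNReal.one_lt_top).ne (by simp)] at h2
  rw [hri] at h1
  simp at h2 h1
  linarith

open Classical in
/-- The word that carries the letter `b` exactly at the positions that precede squares. -/
noncomputable def squareWord (a b : A) (n : ℕ) : A := if IsSquare (n + 1) then b else a

/-- A subharmonic function for `blockPBA` on `squareWord`. -/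
noncomputable def squareWeight (n : ℕ) : Fin 3 → ℝ :=
  -- With `k = n.sqrt`, the next `b` is at position `(k + 1) ^ 2 - 1`. The second factor for state
  -- `0` is the probability of leaving `0` before it; the common factor leaves room for the losses
  -- at all later blocks.
  ![(1 - 4⁻¹ ^ n.sqrt / 2) * (1 - 2⁻¹ ^ ((n.sqrt + 1) ^ 2 - 1 - n)), 1 - 4⁻¹ ^ n.sqrt / 2, 0]

theorem squareWord_mem_blockPBA {a : A} (hab : a ≠ b) :
    squareWord a b ∈ (blockPBA b).probableLanguage := by
  have hp : ∀ (c : ℝ) (n : ℕ), 1 ≤ c → 0 < c⁻¹ ^ n ∧ c⁻¹ ^ n ≤ 1 := fun c n hc =>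
    ⟨by positivity, pow_le_one₀ (by positivity) (inv_le_one_of_one_le₀ hc)⟩
  have hw : ENNReal.ofReal (squareWeight 0 1) ≤
      (blockPBA b).law 1 (squareWord a b) {r | ∀ k, r k ∈ ({2}ᶜ : Set (Fin 3))} := by
    refine (blockPBA b).ofReal_le_law_forall_mem _ _ squareWeight ?_ ?_ ?_ ?_ 1
    · intro n x
      have h1 := hp 4 n.sqrt (by norm_num)
      have h2 := hp 2 ((n.sqrt + 1) ^ 2 - 1 - n) (by norm_num)
      fin_cases x
      · exact mul_nonneg (by linarith) (by linarith)
      · change (0 : ℝ) ≤ 1 - 4⁻¹ ^ n.sqrt / 2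
        linarith
      · exact le_rfl
    · intro n x
      have h1 := hp 4 n.sqrt (by norm_num)
      have h2 := hp 2 ((n.sqrt + 1) ^ 2 - 1 - n) (by norm_num)
      fin_cases x
      · exact mul_le_one₀ (by linarith) (by linarith) (by linarith)
      · change (1 : ℝ) - 4⁻¹ ^ n.sqrt / 2 ≤ 1
        linarith
      · exact zero_le_one
    · intro n x hx
      obtain rfl : x = 2 := by simpa using hx
      rfl
    · intro n x hx
      have hs1 := Nat.sqrt_le' n
      have hs2 := Nat.lt_succ_sqrt' n
      set k := n.sqrt with hk
      rw [Nat.succ_eq_add_one] at hs2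
      rw [Fin.sum_univ_three]
      by_cases hn : n + 1 = (k + 1) ^ 2
      · have hb : squareWord a b n = b := if_pos ⟨k + 1, by rw [hn, sq]⟩
        have hk' : (n + 1).sqrt = k + 1 := by rw [hn, Nat.sqrt_eq']
        have he : (k + 1) ^ 2 - 1 - n = 0 := by lia
        have he' : (k + 1 + 1) ^ 2 - 1 - (n + 1) = 2 * (k + 1) := by
          rw [hn]
          have : (k + 1 + 1) ^ 2 = (k + 1) ^ 2 + 1 + 2 * (k + 1) := by ring
          lia
        have h1 := hp 4 k (by norm_num)
        fin_cases x
        · simp [squareWeight, blockPBA, hb, ← hk, he]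
        · simp [squareWeight, blockPBA, hb, ← hk, hk', he', pow_mul]
          -- With `y = 4⁻¹ ^ (k + 1)` the claim is `1 - 2 * y ≤ (1 - y / 2) * (1 - y)`; the new
          -- block has `2 * (k + 1)` letters before its closing `b`, which gives the factor `1 - y`.
          rw [show ((2 : ℝ) ^ 2) = 4 by norm_num, pow_succ, mul_inv, ← inv_pow]
          nlinarith
        · simp at hx
      · have hb : squareWord a b n = a := by
          refine if_neg ?_
          rintro ⟨j, hj⟩
          refine hn ?_
          have h1 : k < j := by by_contra!; nlinarith
          have h2 : j < k + 2 := by by_contra!; nlinarith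
          obtain rfl : j = k + 1 := by lia
          rw [hj, sq]
        have hk' : (n + 1).sqrt = k := by
          refine (Nat.eq_sqrt'.2 ⟨by lia, by lia⟩).symm
        have he : (k + 1) ^ 2 - 1 - n = (k + 1) ^ 2 - 1 - (n + 1) + 1 := by lia
        fin_cases x
        · change (1 - 4⁻¹ ^ n.sqrt / 2) * (1 - 2⁻¹ ^ ((n.sqrt + 1) ^ 2 - 1 - n)) ≤
            (_ : ℝ) * ((1 - 4⁻¹ ^ (n + 1).sqrt / 2) *
              (1 - 2⁻¹ ^ (((n + 1).sqrt + 1) ^ 2 - 1 - (n + 1)))) +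
            _ * (1 - 4⁻¹ ^ (n + 1).sqrt / 2) + _ * 0
          rw [hk', ← hk, he]
          simp only [blockPBA, hb, hab, if_false]
          simp only [Fin.zero_eta, Matrix.cons_val_zero, Matrix.cons_val_one, NNReal.coe_inv,
            NNReal.coe_ofNat]
          exact le_of_eq (by ring)
        · simp [squareWeight, blockPBA, hb, hab, ← hk, hk']
        · simp at hx
  rw [mem_probableLanguage_iff]
  have hpos : 0 < ENNReal.ofReal (squareWeight 0 1) := by
    rw [ENNReal.ofReal_pos]
    norm_num [squareWeight]
  refine (hpos.trans_le hw).trans_le (measure_mono_ae ?_)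
  filter_upwards [(blockPBA b).ae_law_δ_ne_zero 1 (squareWord a b)] with r hr h2 n
  -- Reading `b` leads only to `0` or `2`, so a run that avoids `2` is in the final state after each
  -- of the infinitely many `b`.
  have hb : squareWord a b ((n + 1) ^ 2 - 1) = b := by
    refine if_pos ⟨n + 1, ?_⟩
    have : 0 < (n + 1) ^ 2 := by positivity
    rw [← sq]; lia
  refine ⟨(n + 1) ^ 2 - 1 + 1, by nlinarith [Nat.sub_add_cancel (Nat.one_le_pow 2 (n + 1) n.succ_pos)],
    ?_⟩
  have h3 := hr.2 ((n + 1) ^ 2 - 1)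
  rw [hb] at h3
  have h4 : r ((n + 1) ^ 2 - 1 + 1) ≠ 2 := h2 _
  change r ((n + 1) ^ 2 - 1 + 1) = 0
  generalize r ((n + 1) ^ 2 - 1 + 1) = x at h3 h4
  generalize r ((n + 1) ^ 2 - 1) = y at h3
  fin_cases x <;> fin_cases y <;> simp_all [blockPBA]

end Block

end PBA

theorem omegaRegular_ssubset_probable (A : Type*) [Nontrivial A] :
    OmegaRegular A ⊂ Probable A := by
  refine ⟨omegaRegular_subset_probable A, fun h => ?_⟩
  obtain ⟨a, b, hab⟩ := exists_pair_ne A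
  obtain ⟨w, hw, hp⟩ := exists_ultimatelyPeriodic_of_omegaRegular
    (h ⟨Fin 3, _, _, inferInstance, PBA.blockPBA b, rfl⟩)
    ⟨_, PBA.squareWord_mem_blockPBA hab⟩
  exact PBA.not_ultimatelyPeriodic_of_mem_blockPBA hw hp

/-! ### Probable languages lie in the Boolean closure of the G_δ sets. -/

namespace PBA

variable {A Q : Type*} [Fintype Q] [MeasurableSpace Q] [DiscreteMeasurableSpace Q]

theorem law_eq_mul_val_le (B : PBA A Q) (q x : Q) (w : ℕ → A) (n : ℕ) :
    B.law q w {r | r n = x} * B.val x (dropSeq n w) ≤ B.val q w := by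
  have h := B.law_inter_dropSeq q w n {c | c ⟨n, Finset.mem_Iic.2 le_rfl⟩ = x}
    B.measurableSet_acceptingRuns
  rw [preimage_dropSeq_acceptingRuns] at h
  have hm : MeasurableSet {r : ℕ → Q | r n = x} :=
    (measurable_pi_apply n : Measurable fun r : ℕ → Q => r n) (measurableSet_singleton x)
  have hC : Preorder.frestrictLe (π := fun _ : ℕ => Q) n ⁻¹'
    {c | c ⟨n, Finset.mem_Iic.2 le_rfl⟩ = x} = {r | r n = x} := rfl
  rw [hC, setLIntegral_congr_fun (g := fun _ => B.val x (dropSeq n w)) hm, setLIntegral_const,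
    mul_comm] at h
  · rw [← h]
    exact measure_mono inter_subset_right
  · intro r hr
    have hr : r n = x := hr
    simp only [hr, val]

/-- The probability of an event up to time `m` depends on the first letters only. -/
theorem law_congr (B : PBA A Q) (q : Q) {v w : ℕ → A} {m : ℕ} (h : ∀ i < m, v i = w i)
    (D : ℕ → Set Q) :
    B.law q v {r | ∀ k ≤ m, r k ∈ D k} = B.law q w {r | ∀ k ≤ m, r k ∈ D k} := by
  have hmap : (B.law q v).map (Preorder.frestrictLe (π := fun _ : ℕ => Q) m) =
      (B.law q w).map (Preorder.frestrictLe (π := fun _ : ℕ => Q) m) := by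
    refine Measure.ext_of_singleton fun x => ?_
    rw [Measure.map_apply (Preorder.measurable_frestrictLe m) (measurableSet_singleton _),
      Measure.map_apply (Preorder.measurable_frestrictLe m) (measurableSet_singleton _)]
    let s : ℕ → Q := fun i => if hi : i ≤ m then x ⟨i, Finset.mem_Iic.2 hi⟩ else q
    have : x = Preorder.frestrictLe (π := fun _ : ℕ => Q) m s := by
      funext i
      simp [s, Preorder.frestrictLe, Finset.mem_Iic.1 i.2]
    rw [this, ← prefixCylinder_eq_preimage, law_prefixCylinder, law_prefixCylinder]
    split_ifs
    · refine Finset.prod_congr rfl fun i hi => ?_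
      rw [h i (Finset.mem_range.1 hi)]
    · rfl
  have hC : {r : ℕ → Q | ∀ k ≤ m, r k ∈ D k} = Preorder.frestrictLe (π := fun _ : ℕ => Q) m ⁻¹'
      {c | ∀ i : Finset.Iic m, c i ∈ D i} := by
    ext r
    exact ⟨fun h i => h i (Finset.mem_Iic.1 i.2), fun h i hi => h ⟨i, Finset.mem_Iic.2 hi⟩⟩
  rw [hC, ← Measure.map_apply (Preorder.measurable_frestrictLe m) .of_discrete, hmap,
    Measure.map_apply (Preorder.measurable_frestrictLe m) .of_discrete]

section Topology

variable {Y : Type*} [TopologicalSpace Y]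

theorem isLocallyConstant_law (B : PBA A Q) (q : Q) {v : Y → ℕ → A} {D : Y → ℕ → Set Q}
    (hv : ∀ k, IsLocallyConstant fun y => v y k) (hD : ∀ k, IsLocallyConstant fun y => D y k)
    (m : ℕ) : IsLocallyConstant fun y => B.law q (v y) {r | ∀ k ≤ m, r k ∈ D y k} := by
  rw [IsLocallyConstant.iff_eventually_eq]
  intro y
  have h1 : ∀ᶠ z in nhds y, ∀ k ∈ Finset.Iic m, v z k = v y k ∧ D z k = D y k :=
    (Filter.eventually_all_finset _).2 fun k _ =>
      ((IsLocallyConstant.iff_eventually_eq _).1 (hv k) y).and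
        ((IsLocallyConstant.iff_eventually_eq _).1 (hD k) y)
  filter_upwards [h1] with z hz
  rw [B.law_congr q (v := v z) (w := v y) fun i hi => (hz i (Finset.mem_Iic.2 hi.le)).1]
  congr 1
  ext r
  exact forall₂_congr fun k hk => by rw [(hz k (Finset.mem_Iic.2 hk)).2]

/-- The probability is the infimum over `m` of quantities that depend on finitely many coordinates,
so its upper level sets are closed. -/
theorem isClosed_setOf_le_law (B : PBA A Q) (q : Q) {v : Y → ℕ → A} {D : Y → ℕ → Set Q}
    (hv : ∀ k, IsLocallyConstant fun y => v y k) (hD : ∀ k, IsLocallyConstant fun y => D y k)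
    (t : ℝ≥0∞) : IsClosed {y | t ≤ B.law q (v y) {r | ∀ k, r k ∈ D y k}} := by
  have : {y | t ≤ B.law q (v y) {r | ∀ k, r k ∈ D y k}} =
      ⋂ m, (fun y => B.law q (v y) {r | ∀ k ≤ m, r k ∈ D y k}) ⁻¹' {s | t ≤ s} := by
    ext y
    have hi : {r : ℕ → Q | ∀ k, r k ∈ D y k} = ⋂ m, {r | ∀ k ≤ m, r k ∈ D y k} := by
      ext r
      simp only [mem_ofPred_eq, mem_iInter]
      exact ⟨fun h _ k _ => h k, fun h k => h k k le_rfl⟩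
    have ha : Antitone fun m => {r : ℕ → Q | ∀ k ≤ m, r k ∈ D y k} :=
      fun m m' hmm r hr k hk => hr k (hk.trans hmm)
    simp only [mem_ofPred_eq, mem_iInter, mem_preimage]
    rw [hi, ha.measure_iInter (fun m => ?_) ⟨0, measure_ne_top _ _⟩, le_iInf_iff]
    exact (measurableSet_forall_mem fun k => {q : Q | k ≤ m → q ∈ D y k}).nullMeasurableSet
  rw [this]
  refine isClosed_iInter fun m => ?_
  rw [← isOpen_compl_iff, ← preimage_compl]
  exact isLocallyConstant_law B q hv hD m _

end Topology

/-- The states `x i` start runs that, with probability at least one half, follow the color `i` and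
avoid the final states. -/
def RejectsApart (B : PBA A Q) {ι : Type*} (v : ℕ → A) (c : ℕ → Q → Option ι) (x : ι → Q) : Prop :=
  ∀ i, 2⁻¹ ≤ B.law (x i) v {r | ∀ k, r k ∈ {q | c k q = some i ∧ q ∉ B.final}}

/-- The words with a suffix on which some states indexed by `ι` reject apart. -/
def rejecting (B : PBA A Q) (ι : Type*) : Set (ℕ → A) :=
  {w | ∃ n, ∃ x : ι → Q, ∃ c, B.RejectsApart (dropSeq n w) c x}

/-- The words with a suffix on which some states indexed by `ι` reject apart, and apart from
a reachable state. -/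
def separating (B : PBA A Q) (ι : Type*) : Set (ℕ → A) :=
  {w | ∃ n q, 0 < B.law B.init w {r | r n = q} ∧ ∃ x : ι → Q, ∃ c,
    B.RejectsApart (dropSeq n w) c x ∧
      2⁻¹ ≤ B.law q (dropSeq n w) {r | ∀ k, r k ∈ {q | c k q = none}}}

/-- At time `0` the run from `x i` sits at `x i`, which must then have color `i`. -/
theorem RejectsApart.injective {B : PBA A Q} {ι : Type*} {v : ℕ → A} {c : ℕ → Q → Option ι}
    {x : ι → Q} (h : B.RejectsApart v c x) : Function.Injective x := by
  have hc : ∀ i, c 0 (x i) = some i := by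
    intro i
    by_contra hne
    have h0 : B.law (x i) v {r | ∀ k, r k ∈ {q | c k q = some i ∧ q ∉ B.final}} = 0 := by
      refine measure_mono_null (fun r hr => ?_) (B.ae_law_zero (x i) v)
      intro h0
      have h1 : r 0 = x i := h0
      have h2 := (hr 0).1
      rw [h1] at h2
      exact hne h2
    have := h i
    rw [h0] at this
    simp at this
  intro i j hij
  have := hc i
  rw [hij, hc j] at this
  exact (Option.some_injective _ this).symm

theorem rejecting_subset_of_equiv (B : PBA A Q) {ι κ : Type*} (e : κ ≃ ι) :
    B.rejecting ι ⊆ B.rejecting κ := by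
  rintro w ⟨n, x, c, h⟩
  refine ⟨n, x ∘ e, fun k q => (c k q).map e.symm, fun j => (h (e j)).trans ?_⟩
  refine measure_mono fun r hr k => ⟨?_, (hr k).2⟩
  simp [(hr k).1]

/-- The empty configuration always exists, and injectivity excludes more than `Fintype.card Q`
states, so there is a last `n` before the condition fails. -/
theorem exists_le_mem_rejecting (B : PBA A Q) (w : ℕ → A) :
    ∃ n ≤ Fintype.card Q, w ∈ B.rejecting (Fin n) ∧ w ∉ B.rejecting (Option (Fin n)) := by
  by_contra! hc
  have h : ∀ n ≤ Fintype.card Q + 1, w ∈ B.rejecting (Fin n) := by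
    intro n
    induction n with
    | zero => exact fun _ => ⟨0, Fin.elim0, fun _ _ => none, fun i => i.elim0⟩
    | succ n ih =>
      exact fun hn => B.rejecting_subset_of_equiv (finSuccEquiv n) (hc n (by lia) (ih (by lia)))
  obtain ⟨n, x, c, hx⟩ := h _ le_rfl
  have := Fintype.card_le_of_injective x hx.injective
  rw [Fintype.card_fin] at this
  lia

/-- Runs that eventually follow their colors can be restarted at later times. -/
theorem exists_forall_half_le_law (B : PBA A Q) {ι : Type*} [Finite ι] (v : ℕ → A)
    (D : ι → ℕ → Set Q) (x : ι → Q)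
    (h : ∀ i, 0 < B.law (x i) v {r | ∃ N, ∀ k, r (N + k) ∈ D i (N + k)}) :
    ∃ N, ∀ m, N ≤ m → ∃ y : ι → Q, ∀ i,
      2⁻¹ ≤ B.law (y i) (dropSeq m v) {r | ∀ k, r k ∈ D i (m + k)} := by
  choose N hN using fun i => B.exists_half_le_law_of_pos (x i) v (D i) (h i)
  obtain ⟨M, hM⟩ := (Set.finite_range N).bddAbove
  refine ⟨M, fun m hm => ?_⟩
  choose y _ hy using fun i => hN i m ((hM (mem_range_self i)).trans hm)
  exact ⟨y, hy⟩

/-- If the value were zero, the reachable state `q` would reject almost surely as well. Its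
uncolored runs eventually avoid the final states, so turning `none` into one more color and
restarting late gives a configuration indexed by `Option ι`. -/
theorem val_pos_of_mem_separating (B : PBA A Q) {ι : Type*} [Finite ι] {w : ℕ → A}
    (hs : w ∈ B.separating ι) (hr : w ∉ B.rejecting (Option ι)) : 0 < B.val B.init w := by
  obtain ⟨n, q, hq, x, c, hx, hn⟩ := hs
  rw [pos_iff_ne_zero]
  intro h0
  have hq0 : B.val q (dropSeq n w) = 0 := by
    have := B.law_eq_mul_val_le B.init q w n
    rw [h0, nonpos_iff_eq_zero, mul_eq_zero] at this
    exact this.resolve_left hq.ne'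
  have h2 : (0 : ℝ≥0∞) < 2⁻¹ := by simp
  obtain ⟨M, hM⟩ := B.exists_forall_half_le_law (dropSeq n w)
    (fun (o : Option ι) k => {q | c k q = o ∧ q ∉ B.final}) (fun o => o.elim q x) (by
      rintro (_ | i)
      · refine h2.trans_le (hn.trans (measure_mono_ae ?_))
        have : ∀ᵐ r ∂(B.law q (dropSeq n w)), r ∉ B.acceptingRuns := by
          rw [ae_iff]
          simp only [not_not]
          exact hq0
        filter_upwards [this] with r h1 h2
        simp only [acceptingRuns, mem_ofPred_eq, not_forall, not_exists, not_and] at h1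
        obtain ⟨N, hN⟩ := h1
        exact ⟨N, fun k => ⟨h2 (N + k), hN _ (by lia)⟩⟩
      · exact h2.trans_le ((hx i).trans (measure_mono fun r hr => ⟨0, fun k => hr (0 + k)⟩)))
  obtain ⟨y, hy⟩ := hM M le_rfl
  refine hr ⟨n + M, y, fun k q => some (c (M + k) q), fun o => ?_⟩
  rw [← dropSeq_dropSeq]
  refine (hy o).trans (measure_mono fun r hr k => ⟨?_, (hr k).2⟩)
  exact congrArg some (hr k).1

open Classical in
theorem mem_separating_of_val_pos (B : PBA A Q) {ι : Type*} [Finite ι] {w : ℕ → A}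
    (hr : w ∈ B.rejecting ι) (hw : 0 < B.val B.init w) : w ∈ B.separating ι := by
  obtain ⟨n, x, c, hx⟩ := hr
  have h2 : (0 : ℝ≥0∞) < 2⁻¹ := by simp
  -- States of value above one half lose their color. Values tend to zero along rejecting runs,
  -- which thus eventually keep their colors, and to one along accepting runs, which eventually
  -- become uncolored.
  let c' : ℕ → Q → Option ι := fun k q =>
    if 2⁻¹ < (B.val q (dropSeq (n + k) w)).toReal then none else c k q
  obtain ⟨M, hM⟩ := B.exists_forall_half_le_law (dropSeq n w)
    (fun i k => {q | c' k q = some i ∧ q ∉ B.final}) x (by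
      intro i
      refine h2.trans_le ((hx i).trans (measure_mono_ae ?_))
      filter_upwards [B.ae_tendsto_val (x i) (dropSeq n w)] with r ht hr
      have hacc : r ∉ B.acceptingRuns := by
        intro hacc
        obtain ⟨k, -, hk⟩ := hacc 0
        exact (hr k).2 hk
      rw [indicator_of_notMem hacc] at ht
      obtain ⟨N, hN⟩ := Filter.eventually_atTop.1
        (ht.eventually (gt_mem_nhds (show (0 : ℝ) < 2⁻¹ by norm_num)))
      refine ⟨N, fun k => ⟨?_, (hr _).2⟩⟩
      have := hN (N + k) (by lia)
      rw [dropSeq_dropSeq] at this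
      exact (if_neg this.not_gt).trans (hr (N + k)).1)
  obtain ⟨M', hM'⟩ := B.exists_half_le_law_of_pos B.init w
    (fun m => {q | n ≤ m → c' (m - n) q = none}) (by
      refine hw.trans_le (measure_mono_ae ?_)
      filter_upwards [B.ae_tendsto_val B.init w] with r ht hr
      rw [indicator_of_mem (show r ∈ B.acceptingRuns from hr)] at ht
      obtain ⟨N, hN⟩ := Filter.eventually_atTop.1
        (ht.eventually (lt_mem_nhds (show (2⁻¹ : ℝ) < 1 by norm_num)))
      refine ⟨N, fun k hn => if_pos ?_⟩
      rw [show n + (N + k - n) = N + k by lia]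
      exact hN _ (by lia))
  -- Both restarts must happen at one common time; restarting also restores the bound one half.
  obtain ⟨y, hy⟩ := hM (max M M') (le_max_left _ _)
  obtain ⟨q, hq, hqn⟩ := hM' (n + max M M') (by have := le_max_right M M'; lia)
  refine ⟨n + max M M', q, hq, y, fun k => c' (max M M' + k), ?_, ?_⟩
  · intro i
    rw [← dropSeq_dropSeq]
    exact hy i
  · refine hqn.trans (measure_mono fun r hr k => ?_)
    have := hr k (by lia)
    rwa [show n + max M M' + k - n = max M M' + k by lia] at this

theorem probableLanguage_eq_biUnion (B : PBA A Q) : B.probableLanguage =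
    ⋃ n ∈ Finset.range (Fintype.card Q + 1),
      B.separating (Fin n) \ B.rejecting (Option (Fin n)) := by
  ext w
  rw [mem_probableLanguage_iff]
  simp only [mem_iUnion, Finset.mem_range, exists_prop]
  constructor
  · intro h
    obtain ⟨n, hn, h1, h2⟩ := B.exists_le_mem_rejecting w
    exact ⟨n, by lia, B.mem_separating_of_val_pos h1 h, h2⟩
  · rintro ⟨n, -, h1, h2⟩
    exact B.val_pos_of_mem_separating h1 h2

section Borel

variable [TopologicalSpace A] [DiscreteTopology A]

theorem isLocallyConstant_letter {Y : Type*} [TopologicalSpace Y] {v : Y → ℕ → A}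
    (hv : Continuous v) (k : ℕ) : IsLocallyConstant fun y => v y k :=
  (IsLocallyConstant.iff_continuous _).2 ((continuous_apply k).comp hv)

/-- The condition depends on the first `n` letters only. -/
theorem isClosed_setOf_reachable (B : PBA A Q) (n : ℕ) (q : Q) :
    IsClosed {w | 0 < B.law B.init w {r | r n = q}} := by
  have h := isLocallyConstant_law B B.init (v := fun w : ℕ → A => w)
    (D := fun _ k => {x | k = n → x = q}) (isLocallyConstant_letter continuous_id)
    (fun k => IsLocallyConstant.const _) n
  have he : {w | 0 < B.law B.init w {r | r n = q}} = (fun w : ℕ → A => B.law B.init w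
      {r | ∀ k ≤ n, r k ∈ {x | k = n → x = q}}) ⁻¹' {t | 0 < t} := by
    ext w
    have : {r : ℕ → Q | r n = q} = {r | ∀ k ≤ n, r k ∈ {x | k = n → x = q}} := by
      ext r
      refine ⟨fun h k _ hk => ?_, fun h => h n le_rfl rfl⟩
      rw [hk]
      exact h
    rw [this]
    rfl
  rw [he, ← isOpen_compl_iff, ← preimage_compl]
  exact h _

variable {ι : Type*}

theorem isClosed_setOf_follows [TopologicalSpace (Option ι)] [DiscreteTopology (Option ι)]
    (B : PBA A Q) (q : Q) (g : (Q → Option ι) → Set Q) :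
    IsClosed {p : (ℕ → A) × (ℕ → Q → Option ι) |
      2⁻¹ ≤ B.law q p.1 {r | ∀ k, r k ∈ g (p.2 k)}} := by
  have h : ∀ k, IsLocallyConstant fun p : (ℕ → A) × (ℕ → Q → Option ι) => p.2 k := fun k =>
    (IsLocallyConstant.iff_continuous _).2 ((continuous_apply k).comp continuous_snd)
  exact isClosed_setOf_le_law B q (v := fun p : (ℕ → A) × (ℕ → Q → Option ι) => p.1)
    (D := fun p k => g (p.2 k)) (isLocallyConstant_letter continuous_fst)
    (fun k => (h k).comp g) 2⁻¹

theorem isClosed_setOf_rejectsApart [TopologicalSpace (Option ι)] [DiscreteTopology (Option ι)]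
    (B : PBA A Q) (x : ι → Q) :
    IsClosed {p : (ℕ → A) × (ℕ → Q → Option ι) | B.RejectsApart p.1 p.2 x} := by
  have he : {p : (ℕ → A) × (ℕ → Q → Option ι) | B.RejectsApart p.1 p.2 x} =
      ⋂ i, {p | 2⁻¹ ≤ B.law (x i) p.1 {r | ∀ k, r k ∈ {q | p.2 k q = some i ∧ q ∉ B.final}}} := by
    ext p
    rw [mem_iInter]
    rfl
  rw [he]
  exact isClosed_iInter fun i =>
    B.isClosed_setOf_follows (x i) fun c => {q | c q = some i ∧ q ∉ B.final}

variable [Finite ι]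

/-- Colorings form a compact space, so projecting them away keeps sets closed; the choices of `n`
and `x` are countable. -/
theorem isGδ_compl_rejecting (B : PBA A Q) : IsGδ (B.rejecting ι)ᶜ := by
  let _ : TopologicalSpace (Option ι) := ⊥
  have : DiscreteTopology (Option ι) := ⟨rfl⟩
  have he : B.rejecting ι = ⋃ n, ⋃ x : ι → Q, dropSeq n ⁻¹'
      (Prod.fst '' {p : (ℕ → A) × (ℕ → Q → Option ι) | B.RejectsApart p.1 p.2 x}) := by
    ext w
    simp [rejecting]
  rw [he]
  simp only [compl_iUnion]
  refine IsGδ.iInter fun n => IsGδ.iInter fun x => IsOpen.isGδ ?_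
  rw [isOpen_compl_iff]
  exact (isClosedMap_fst_of_compactSpace _ (B.isClosed_setOf_rejectsApart x)).preimage
    (continuous_dropSeq n)

theorem isGδ_compl_separating (B : PBA A Q) : IsGδ (B.separating ι)ᶜ := by
  let _ : TopologicalSpace (Option ι) := ⊥
  have : DiscreteTopology (Option ι) := ⟨rfl⟩
  have he : B.separating ι = ⋃ n, ⋃ q, ⋃ x : ι → Q, {w | 0 < B.law B.init w {r | r n = q}} ∩
      dropSeq n ⁻¹' (Prod.fst '' ({p : (ℕ → A) × (ℕ → Q → Option ι) | B.RejectsApart p.1 p.2 x} ∩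
        {p | 2⁻¹ ≤ B.law q p.1 {r | ∀ k, r k ∈ {q | p.2 k q = none}}})) := by
    ext w
    simp [separating]
  rw [he]
  simp only [compl_iUnion]
  refine IsGδ.iInter fun n => IsGδ.iInter fun q => IsGδ.iInter fun x => IsOpen.isGδ ?_
  rw [isOpen_compl_iff]
  exact (B.isClosed_setOf_reachable n q).inter ((isClosedMap_fst_of_compactSpace _
    ((B.isClosed_setOf_rejectsApart x).inter (B.isClosed_setOf_follows q fun c => {q | c q = none}))).preimage
    (continuous_dropSeq n))

end Borel

end PBA

theorem probable_subset_BClGδ (A : Type*) [TopologicalSpace A] [DiscreteTopology A] :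
    Probable A ⊆ BClGδ A := by
  rintro _ ⟨Q, _, _, _, B, rfl⟩
  rw [B.probableLanguage_eq_biUnion]
  change _ ∈ BooleanSubalgebra.closure {L : Set (ℕ → A) | IsGδ L}
  have key : ∀ {L : Set (ℕ → A)}, IsGδ Lᶜ →
      L ∈ BooleanSubalgebra.closure {L : Set (ℕ → A) | IsGδ L} := fun h =>
    BooleanSubalgebra.compl_mem_iff.1 (BooleanSubalgebra.subset_closure h)
  generalize Finset.range (Fintype.card Q + 1) = s
  induction s using Finset.induction_on with
  | empty => simpa using BooleanSubalgebra.bot_mem (L := BooleanSubalgebra.closure {L : Set (ℕ → A) | IsGδ L})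
  | insert n s _ ih =>
    rw [Finset.set_biUnion_insert]
    exact BooleanSubalgebra.sup_mem (BooleanSubalgebra.sdiff_mem (key B.isGδ_compl_separating)
      (key B.isGδ_compl_rejecting)) ih

theorem mainTheorem7 {A : Type*} [Finite A] [Nontrivial A]
    [TopologicalSpace A] [DiscreteTopology A] :
    OmegaRegular A ⊂ Probable A ∧
    Probable A ⊂ BClGδ A ∧
    (∀ L ∈ Probable A, closure L ∈ OmegaRegular A) ∧
    (∀ a b : A, a ≠ b →
      ¬ UltimatelyPeriodic (abWord a b) ∧
      IsClosed ({abWord a b} : Set (ℕ → A)) ∧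
      ({abWord a b} : Set (ℕ → A)) ∈ BClGδ A ∧
      ({abWord a b} : Set (ℕ → A)) ∉ Probable A) := by
  have h4 : ∀ a b : A, a ≠ b → ({abWord a b} : Set (ℕ → A)) ∉ Probable A :=
    fun a b hab => singleton_not_mem_probable (not_ultimatelyPeriodic_abWord hab)
  refine ⟨omegaRegular_ssubset_probable A, ⟨probable_subset_BClGδ A, fun h => ?_⟩,
    fun L hL => closure_mem_omegaRegular hL, fun a b hab =>
      ⟨not_ultimatelyPeriodic_abWord hab, isClosed_singleton, singleton_mem_BClGδ _, h4 a b hab⟩⟩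
  obtain ⟨a, b, hab⟩ := exists_pair_ne A
  exact h4 a b hab (h (singleton_mem_BClGδ _))
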